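/- Let $0<q<1$. On $\mathscr H_+=\ell^2(\mathbb N)\otimes\ell^2(\mathbb Z)$ (with $0\in\mathbb N$) consider the bounded operators $$a_+=\Big(\sum_{k\ge 1}\sqrt{1-q^{2k}}\,e_{k-1,k}\Big)\otimes 1,\qquad b_+=\Big(\sum_{k\ge 0}q^k e_{kk}\Big)\otimes S,$$ where $e_{ij}$ are the matrix units and $S e_k=e_{k+1}$ is the forward bilateral shift, and on $\ell^2(\mathbb N)$ the operators $$Y^{(+)}=\sum_{k\ge 1}\sqrt{1-q^{4k}}\,e_{k-1,k},\qquad W^{(+)}=\sum_{k\ge 0}q^{2k}e_{kk}.$$ Let $\widetilde\alpha_+(W)$ be the $+$-component of the image of the generator $W$ under the coaction $\widetilde\alpha$ of $\mathscr L^\infty(SU_q(2))$ on the equatorial Podleś sphere, that is, the bounded operator $$\widetilde\alpha_+(W)=a_+^*b_+^*\otimes (Y^{(+)})^*+\big(1-(1+q^2)b_+^*b_+\big)\otimes W^{(+)}+b_+a_+\otimes Y^{(+)}$$ on $\mathscr H_+\otimes\ell^2(\mathbb N)$. Put $J^{(+)}=\mathbb Z$ and $J^{(-)}=\mathbb N$,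 and write $(a;q)_n=\prod_{k=0}^{n-1}(1-q^ka)$ for $n\in\mathbb N\cup\{\infty\}$, and $${}_3\varphi_2\left(\begin{matrix}a,b,c\\ d,e\end{matrix}\,\Big|\,q,z\right)=\sum_{l\ge 0}\frac{(a;q)_l(b;q)_l(c;q)_l}{(q;q)_l(d;q)_l(e;q)_l}z^l,$$ where the sum of a terminating series is taken up to the last index before the numerator vanishes identically. Then: 1. The spectrum of $\widetilde\alpha_+(W)$ equals $\{\pm q^{2r}\mid r\in\mathbb N\}\cup\{0\}$, and $0$ is not an eigenvalue of $\widetilde\alpha_+(W)$. 2. For every $r\in\mathbb N$ and each choice of the sign $\pm$, an orthonormal (Hilbert space) basis of the eigenspace of $\widetilde\alpha_+(W)$ for the eigenvalue $\pm q^{2r}$ is given by the vectors $\xi_{r,\pm}^{(t,p)}$ with $t,p\in\mathbb Z$ and $p+r\in J^{(\pm)}$, where $$\xi_{r,\pm}^{(t,p)}=\sum_{n=0}^\infty Q_{q^2}(p_\pm,r,n)\,e_n\otimes e_{t-n}\otimes e_{p+n},$$ the series converging in $\mathscr H_+\otimes\ell^2(\mathbb N)$, with $e_{k}=0$ in the last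 factor for $k<0$, and $$Q_{q^2}(p_\pm,r,n)=(\mp q)^r(\pm1)^n q^{\frac{n(n-1)}2}\,\frac{(\mp q^{2p+2r+2};q^2)_n\,(q^{4p+4n+4};q^4)_\infty^{1/2}}{(\mp q^{2p+2r+2};q^2)_\infty^{1/2}(q^4;q^4)_r^{1/2}(-1;q^2)_\infty^{1/2}(q^2;q^2)_n^{1/2}}\;{}_3\varphi_2\left(\begin{matrix}q^{-2n},\,q^{-2r},\,\pm q^{-2p-2n}\\ \mp q^{-2p-2n-2r},\,0\end{matrix}\,\Big|\,q^2,q^2\right).$$ -/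

import Mathlib

/-- The complex Hilbert space `ℓ²(I)`. The Hilbert space tensor product `ℓ²(I) ⊗ ℓ²(J)` is realised
as `ℓ²(I × J)`, with `(x ⊗ y)(i, j) = x i * y j`. -/
abbrev L2 (I : Type) : Type := lp (fun _ : I => ℂ) 2

theorem memlp_two_iff {I : Type} (f : I → ℂ) :
    Memℓp f 2 ↔ Summable fun i => ‖f i‖ ^ 2 := by
  rw [memℓp_gen_iff (by norm_num)]
  simp

theorem L2_summable {I : Type} (x : L2 I) : Summable fun i => ‖x i‖ ^ 2 :=
  (memlp_two_iff _).1 (lp.memℓp x)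

theorem L2_norm_sq {I : Type} (x : L2 I) : ‖x‖ ^ 2 = ∑' i, ‖x i‖ ^ 2 := by
  have h := lp.norm_rpow_eq_tsum (p := 2) (by norm_num) x
  simpa using h

theorem L2_norm_le {I : Type} (x : L2 I) {C : ℝ} (hC : 0 ≤ C)
    (h : ∑' i, ‖x i‖ ^ 2 ≤ C ^ 2) : ‖x‖ ≤ C := by
  rw [← L2_norm_sq] at h
  exact le_of_sq_le_sq h hC

theorem memlp_comp {I K : Type} (f : I → K) (hf : Function.Injective f) (x : L2 K) :
    Memℓp (fun i => x (f i)) 2 :=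
  (memlp_two_iff _).2 ((L2_summable x).comp_injective hf)

/-- The slice `i ↦ x (e (i, j))` of a vector `x` of `ℓ²(K)`, where `e` identifies `I × J` with `K`. -/
noncomputable def slice {I J K : Type} (e : I × J ≃ K) (j : J) (x : L2 K) : L2 I :=
  ⟨fun i => x (e (i, j)), memlp_comp (fun i => e (i, j)) (fun a b h => by simpa using h) x⟩

theorem summable_slices {I J K : Type} (e : I × J ≃ K) (x : L2 K) :
    Summable (fun j => ‖slice e j x‖ ^ 2) ∧ ∑' j, ‖slice e j x‖ ^ 2 = ‖x‖ ^ 2 := by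
  have h1 : Summable fun c : J × I => ‖x (e c.swap)‖ ^ 2 :=
    (L2_summable x).comp_injective (e.injective.comp Prod.swap_injective)
  have h2 : ∀ j, ‖slice e j x‖ ^ 2 = ∑' i, ‖x (e (i, j))‖ ^ 2 := fun j => L2_norm_sq _
  refine ⟨?_, ?_⟩
  · simp_rw [h2]
    exact h1.prod
  · simp_rw [h2, L2_norm_sq x]
    rw [← ((Equiv.prodComm J I).trans e).tsum_eq (fun k => ‖x k‖ ^ 2)]
    exact (h1.tsum_prod).symm

/-- Letting `T` act on every slice does not increase the norm by more than the factor `‖T‖`. -/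
theorem summable_amplify {I J K : Type} (e : I × J ≃ K) (T : L2 I →L[ℂ] L2 I) (x : L2 K) :
    (Summable fun k => ‖T (slice e (e.symm k).2 x) (e.symm k).1‖ ^ 2) ∧
      ∑' k, ‖T (slice e (e.symm k).2 x) (e.symm k).1‖ ^ 2 ≤ (‖T‖ * ‖x‖) ^ 2 := by
  obtain ⟨hs, ht⟩ := summable_slices e x
  have hle : ∀ j, ‖T (slice e j x)‖ ^ 2 ≤ ‖T‖ ^ 2 * ‖slice e j x‖ ^ 2 := fun j => by
    rw [← mul_pow]
    exact pow_le_pow_left₀ (norm_nonneg _) (T.le_opNorm _) 2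
  have hsT : Summable fun j => ‖T (slice e j x)‖ ^ 2 :=
    Summable.of_nonneg_of_le (fun _ => by positivity) hle (hs.mul_left _)
  let E : J × I ≃ K := (Equiv.prodComm J I).trans e
  have hp : Summable fun c : J × I => ‖T (slice e c.1 x) c.2‖ ^ 2 := by
    rw [summable_prod_of_nonneg (fun _ => by positivity)]
    refine ⟨fun j => L2_summable (T (slice e j x)), ?_⟩
    simpa only [← L2_norm_sq] using hsT
  have hE : (fun k => ‖T (slice e (e.symm k).2 x) (e.symm k).1‖ ^ 2) ∘ E =
      fun c : J × I => ‖T (slice e c.1 x) c.2‖ ^ 2 := by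
    funext c
    simp [E]
  refine ⟨E.summable_iff.1 (hE ▸ hp), ?_⟩
  rw [← E.tsum_eq]
  change ∑' c, ((fun k => ‖T (slice e (e.symm k).2 x) (e.symm k).1‖ ^ 2) ∘ E) c ≤ _
  rw [hE, hp.tsum_prod]
  simp only [← L2_norm_sq]
  calc ∑' j, ‖T (slice e j x)‖ ^ 2 ≤ ∑' j, ‖T‖ ^ 2 * ‖slice e j x‖ ^ 2 :=
        hsT.tsum_le_tsum hle (hs.mul_left _)
    _ = (‖T‖ * ‖x‖) ^ 2 := by rw [tsum_mul_left, ht, mul_pow]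

/-- The bounded operator on `ℓ²(K) ≅ ℓ²(I × J)` which applies `T` to the first tensor factor. -/
noncomputable def amplify {I J K : Type} (e : I × J ≃ K) (T : L2 I →L[ℂ] L2 I) :
    L2 K →L[ℂ] L2 K :=
  LinearMap.mkContinuous
    { toFun := fun x => ⟨fun k => T (slice e (e.symm k).2 x) (e.symm k).1,
        (memlp_two_iff _).2 (summable_amplify e T x).1⟩
      map_add' := fun x y => by
        ext k
        have h : slice e (e.symm k).2 (x + y) =
            slice e (e.symm k).2 x + slice e (e.symm k).2 y := by ext i; rfl
        change T (slice e (e.symm k).2 (x + y)) (e.symm k).1 = _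
        rw [h, map_add]
        rfl
      map_smul' := fun c x => by
        ext k
        have h : slice e (e.symm k).2 (c • x) = c • slice e (e.symm k).2 x := by ext i; rfl
        change T (slice e (e.symm k).2 (c • x)) (e.symm k).1 = _
        rw [h, map_smul]
        rfl }
    ‖T‖
    (fun x => L2_norm_le _ (by positivity) (summable_amplify e T x).2)

/-- The tensor product `T ⊗ S = (T ⊗ 1)(1 ⊗ S)` of bounded operators, on
`ℓ²(I) ⊗ ℓ²(J) = ℓ²(I × J)`. -/
noncomputable def opTensor {I J : Type} (T : L2 I →L[ℂ] L2 I) (S : L2 J →L[ℂ] L2 J) :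
    L2 (I × J) →L[ℂ] L2 (I × J) :=
  amplify (Equiv.refl (I × J)) T ∘L amplify (Equiv.prodComm J I) S

theorem summable_weighted {I : Type} (f : I → I) (hf : Function.Injective f) (w : I → ℝ)
    (hw : ∀ i, |w i| ≤ 1) (x : L2 I) :
    (Summable fun i => ‖(w i : ℂ) * x (f i)‖ ^ 2) ∧
      ∑' i, ‖(w i : ℂ) * x (f i)‖ ^ 2 ≤ (1 * ‖x‖) ^ 2 := by
  have hle : ∀ i, ‖(w i : ℂ) * x (f i)‖ ^ 2 ≤ ‖x (f i)‖ ^ 2 := fun i => by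
    refine pow_le_pow_left₀ (norm_nonneg _) ?_ 2
    rw [norm_mul, Complex.norm_real, Real.norm_eq_abs]
    exact mul_le_of_le_one_left (norm_nonneg _) (hw i)
  have hx : Summable fun i => ‖x (f i)‖ ^ 2 := (L2_summable x).comp_injective hf
  have hs := Summable.of_nonneg_of_le (fun _ => by positivity) hle hx
  refine ⟨hs, (hs.tsum_le_tsum hle hx).trans ?_⟩
  rw [one_mul, L2_norm_sq]
  exact hx.tsum_le_tsum_of_inj f hf (fun _ _ => by positivity) (fun _ => le_rfl) (L2_summable x)

/-- The bounded operator `(T x)(i) = w i * x (f i)` on `ℓ²(I)`, i.e. `T = ∑ i, w i • e_{i, f i}` in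
terms of matrix units, for an injective map `f` and real weights bounded by `1`. -/
noncomputable def weightedShift {I : Type} (f : I → I) (hf : Function.Injective f) (w : I → ℝ)
    (hw : ∀ i, |w i| ≤ 1) : L2 I →L[ℂ] L2 I :=
  LinearMap.mkContinuous
    { toFun := fun x => ⟨fun i => (w i : ℂ) * x (f i),
        (memlp_two_iff _).2 (summable_weighted f hf w hw x).1⟩
      map_add' := fun x y => by
        ext i
        change (w i : ℂ) * (x (f i) + y (f i)) = (w i : ℂ) * x (f i) + (w i : ℂ) * y (f i)
        ring
      map_smul' := fun c x => by
        ext i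
        change (w i : ℂ) * (c * x (f i)) = c * ((w i : ℂ) * x (f i))
        ring }
    1
    (fun x => L2_norm_le _ (by positivity) (summable_weighted f hf w hw x).2)

theorem abs_sqrt_one_sub_le (q : ℝ) (m : ℕ) : |√(1 - (q ^ 2) ^ m)| ≤ 1 := by
  rw [abs_of_nonneg (Real.sqrt_nonneg _), Real.sqrt_le_one]
  have : 0 ≤ (q ^ 2) ^ m := by positivity
  linarith

theorem abs_pow_le_one' (q : ℝ) (hq0 : 0 < q) (hq1 : q < 1) (m : ℕ) : |q ^ m| ≤ 1 := by
  rw [abs_of_nonneg (by positivity)]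
  exact pow_le_one₀ hq0.le hq1.le

/-- The sign `±1` as a real number. -/
def sgn (ε : ℤˣ) : ℝ := ((ε : ℤ) : ℝ)

theorem abs_sgn (ε : ℤˣ) : |sgn ε| = 1 := by
  rcases Int.units_eq_one_or ε with rfl | rfl <;> simp [sgn]

/-- The forward bilateral shift `S e_k = e_{k+1}` on `ℓ²(ℤ)`. -/
noncomputable def bilateralShift : L2 ℤ →L[ℂ] L2 ℤ :=
  weightedShift (fun k => k - 1) (sub_left_injective) (fun _ => 1) (fun _ => by simp)

/-- `a₊ = (∑_{k ≥ 1} √(1 - q^{2k}) e_{k-1,k}) ⊗ 1` on `ℋ₊ = ℓ²(ℕ) ⊗ ℓ²(ℤ)`. -/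
noncomputable def aPlus (q : ℝ) : L2 (ℕ × ℤ) →L[ℂ] L2 (ℕ × ℤ) :=
  opTensor
    (weightedShift (fun k : ℕ => k + 1) (add_left_injective 1)
      (fun k => √(1 - (q ^ 2) ^ (k + 1))) (fun k => abs_sqrt_one_sub_le q (k + 1)))
    1

/-- `b₊ = (∑_{k ≥ 0} q^k e_{k,k}) ⊗ S` on `ℋ₊ = ℓ²(ℕ) ⊗ ℓ²(ℤ)`. -/
noncomputable def bPlus (q : ℝ) (hq0 : 0 < q) (hq1 : q < 1) :
    L2 (ℕ × ℤ) →L[ℂ] L2 (ℕ × ℤ) :=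
  opTensor
    (weightedShift (fun k : ℕ => k) (fun _ _ h => h) (fun k => q ^ k)
      (fun k => abs_pow_le_one' q hq0 hq1 k))
    bilateralShift

/-- The component `Y^{(ε)} = ε ∑_{k ≥ 1} √(1 - q^{4k}) e_{k-1,k}` of the generator `Y` of the
equatorial Podleś sphere, on `ℓ²(ℕ)`. -/
noncomputable def podlesY (q : ℝ) (ε : ℤˣ) : L2 ℕ →L[ℂ] L2 ℕ :=
  (sgn ε : ℂ) • weightedShift (fun k : ℕ => k + 1) (add_left_injective 1)
    (fun k => √(1 - (q ^ 2) ^ (2 * (k + 1)))) (fun k => abs_sqrt_one_sub_le q (2 * (k + 1)))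

/-- The component `W^{(ε)} = ε ∑_{k ≥ 0} q^{2k} e_{k,k}` of the generator `W` of the equatorial
Podleś sphere, on `ℓ²(ℕ)`. -/
noncomputable def podlesW (q : ℝ) (hq0 : 0 < q) (hq1 : q < 1) (ε : ℤˣ) : L2 ℕ →L[ℂ] L2 ℕ :=
  (sgn ε : ℂ) • weightedShift (fun k : ℕ => k) (fun _ _ h => h) (fun k => q ^ (2 * k))
    (fun k => abs_pow_le_one' q hq0 hq1 (2 * k))

/-- The component `α̃_ε(W) = (ι ⊗ π_ε) α̃(W)` of the image of `W` under the coaction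
`α̃(W) = a₊* b₊* ⊗ Y* + (1 - (1 + q²) b₊* b₊) ⊗ W + b₊ a₊ ⊗ Y`, on
`ℋ₊ ⊗ ℓ²(ℕ) = ℓ²(ℕ) ⊗ ℓ²(ℤ) ⊗ ℓ²(ℕ)`. -/
noncomputable def alphaTildeW (q : ℝ) (hq0 : 0 < q) (hq1 : q < 1) (ε : ℤˣ) :
    L2 ((ℕ × ℤ) × ℕ) →L[ℂ] L2 ((ℕ × ℤ) × ℕ) :=
  opTensor (star (aPlus q) * star (bPlus q hq0 hq1)) (star (podlesY q ε))
    + opTensor (1 - ((1 + q ^ 2 : ℝ) : ℂ) • (star (bPlus q hq0 hq1) * bPlus q hq0 hq1))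
        (podlesW q hq0 hq1 ε)
    + opTensor (bPlus q hq0 hq1 * aPlus q) (podlesY q ε)

/-- The index sets `I₋^{(+)} = ℤ` and `I₋^{(-)} = {m ∈ ℤ | m < 0}`. -/
def indexI (ε : ℤˣ) : Set ℤ := if ε = 1 then Set.univ else {m | m < 0}

/-- The index sets `J^{(±)} = -I₋^{(±)} - 1`, that is, `J^{(+)} = ℤ` and `J^{(-)} = ℕ`. -/
def indexJ (ε : ℤˣ) : Set ℤ := {j | -j - 1 ∈ indexI ε}

/-- The finite `q`-shifted factorial `(a; q)_n`. -/
noncomputable def qPoch (a q : ℝ) (n : ℕ) : ℝ := ∏ k ∈ Finset.range n, (1 - q ^ k * a)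

/-- The infinite `q`-shifted factorial `(a; q)_∞`. -/
noncomputable def qPochInf (a q : ℝ) : ℝ := ∏' k : ℕ, (1 - q ^ k * a)

/-- The basic hypergeometric series `₃φ₂(a, b, c; d, e | q, z)`. -/
noncomputable def phi32 (a b c d e q z : ℝ) : ℝ :=
  ∑' l : ℕ, qPoch a q l * qPoch b q l * qPoch c q l /
    (qPoch q q l * qPoch d q l * qPoch e q l) * z ^ l

/-- The coefficient `Q_{q²}(p_ε, r, n)`. -/
noncomputable def coeffQ (q : ℝ) (ε : ℤˣ) (p : ℤ) (r n : ℕ) : ℝ :=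
  (-sgn ε * q) ^ r * sgn ε ^ n * q ^ (n * (n - 1) / 2)
    * (qPoch (-sgn ε * q ^ (2 * p + 2 * r + 2)) (q ^ 2) n
        * √(qPochInf (q ^ (4 * p + 4 * n + 4)) (q ^ 4))
      / (√(qPochInf (-sgn ε * q ^ (2 * p + 2 * r + 2)) (q ^ 2))
        * √(qPoch (q ^ 4) (q ^ 4) r)
        * √(qPochInf (-1) (q ^ 2))
        * √(qPoch (q ^ 2) (q ^ 2) n)))
    * phi32 (q ^ (-2 * (n : ℤ))) (q ^ (-2 * (r : ℤ))) (sgn ε * q ^ (-2 * p - 2 * n))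
        (-sgn ε * q ^ (-2 * p - 2 * n - 2 * r)) 0 (q ^ 2) (q ^ 2)

/-- The vector `e_n ⊗ e_m ⊗ e_k` of `ℓ²(ℕ) ⊗ ℓ²(ℤ) ⊗ ℓ²(ℕ)`, where `e_k = 0` for `k < 0`. -/
noncomputable def basisVec (n : ℕ) (m k : ℤ) : L2 ((ℕ × ℤ) × ℕ) :=
  if 0 ≤ k then lp.single 2 ((n, m), k.toNat) 1 else 0

/-! The operator preserves n + m and k - n on the vectors e_n ⊗ e_m ⊗ e_k. The standard basis
therefore splits into chains (`chainIdx t p`), and on each chain the operator is a self-adjoint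
Jacobi matrix with diagonal `onDiag` and positive off-diagonal `offDiag` (`alphaTildeW_apply`).

Put Q = q², b = -ε q^{2p}, c = 1. On a vector of the form `coeffWeight` times a function of n, the
eigenvalue equation for ε q^{2r} becomes the q-difference equation of a q-Meixner polynomial of
degree r (`meixner_difference`, `coeffQ_recurrence`), and `qPoch_mul_phi32` identifies this
polynomial with the ₃φ₂ of the statement. Its norm is computed by lowering the degree: forward and
backward shifts are adjoint up to a telescoping term, and degree zero is the ₁φ₁ summation formula
(`hasSum_phi11Term`, `hasSum_meixner_sq`). Orthogonality needs no computation: within a chain the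
eigenvalues differ, and distinct chains have disjoint supports.

Completeness is a Hilbert-Schmidt count. On a chain the sum of the squared norms of the columns
equals the sum of the squared known eigenvalues (`hasSum_norm_alphaTildeW_sq`,
`hasSum_chainLabel_sq`), so Bessel's inequality is an equality on every column and the operator
kills whatever is orthogonal to the eigenvectors. Its kernel is trivial: a kernel vector solves a
three-term recurrence with rapidly decreasing coefficients, which has no nonzero bounded solution
(`eq_zero_of_recurrence`). The eigenvectors thus form a Hilbert basis, which gives the spectrum and
the eigenspaces. -/

/-! ### q-shifted factorials and the ₁φ₁ summation formula. -/

section QSeries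

open Filter Topology

variable {Q : ℝ}

theorem triangle_succ' (n : ℕ) : (n + 1) * n / 2 = n * (n - 1) / 2 + n := Nat.triangle_succ n

theorem qPoch_zero (a Q : ℝ) : qPoch a Q 0 = 1 := by simp [qPoch]

theorem qPoch_succ (a Q : ℝ) (n : ℕ) :
    qPoch a Q (n + 1) = qPoch a Q n * (1 - Q ^ n * a) := by
  simp [qPoch, Finset.prod_range_succ]

theorem qPoch_succ' (a Q : ℝ) (n : ℕ) :
    qPoch a Q (n + 1) = (1 - a) * qPoch (a * Q) Q n := by
  simp only [qPoch, Finset.prod_range_succ', pow_zero, one_mul]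
  rw [mul_comm]
  congr 1
  exact Finset.prod_congr rfl fun k _ => by ring

theorem summable_pow_mul (hQ0 : 0 ≤ Q) (hQ1 : Q < 1) (a : ℝ) :
    Summable fun k : ℕ => -(Q ^ k * a) :=
  ((summable_geometric_of_lt_one hQ0 hQ1).mul_right a).neg

theorem multipliable_qPoch (hQ0 : 0 ≤ Q) (hQ1 : Q < 1) (a : ℝ) :
    Multipliable fun k : ℕ => 1 - Q ^ k * a := by
  simpa only [sub_eq_add_neg] using
    multipliable_one_add_of_summable (summable_pow_mul hQ0 hQ1 a).norm

theorem tendsto_qPoch (hQ0 : 0 ≤ Q) (hQ1 : Q < 1) (a : ℝ) :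
    Tendsto (qPoch a Q) atTop (𝓝 (qPochInf a Q)) :=
  (multipliable_qPoch hQ0 hQ1 a).hasProd.tendsto_prod_nat

theorem qPochInf_eq (hQ0 : 0 ≤ Q) (hQ1 : Q < 1) (a : ℝ) :
    qPochInf a Q = (1 - a) * qPochInf (a * Q) Q := by
  refine tendsto_nhds_unique ((tendsto_qPoch hQ0 hQ1 a).comp (tendsto_add_atTop_nat 1)) ?_
  refine ((tendsto_qPoch hQ0 hQ1 (a * Q)).const_mul (1 - a)).congr fun n => ?_
  exact (qPoch_succ' a Q n).symm

theorem qPochInf_eq_qPoch_mul (hQ0 : 0 ≤ Q) (hQ1 : Q < 1) (a : ℝ) (n : ℕ) :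
    qPochInf a Q = qPoch a Q n * qPochInf (a * Q ^ n) Q := by
  induction n with
  | zero => simp [qPoch_zero]
  | succ n ih =>
    rw [ih, qPoch_succ, qPochInf_eq hQ0 hQ1 (a * Q ^ n)]
    ring_nf

theorem qPochInf_eq_zero (hQ0 : 0 ≤ Q) (hQ1 : Q < 1) {a : ℝ} {k : ℕ} (h : a * Q ^ k = 1) :
    qPochInf a Q = 0 := by
  rw [qPochInf_eq_qPoch_mul hQ0 hQ1 a (k + 1), qPoch_succ, mul_comm (Q ^ k), h]
  simp

theorem qPochInf_ne_zero (hQ0 : 0 ≤ Q) (hQ1 : Q < 1) {a : ℝ} (h : ∀ k : ℕ, a * Q ^ k ≠ 1) :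
    qPochInf a Q ≠ 0 := by
  have := tprod_one_add_ne_zero_of_summable (f := fun k : ℕ => -(Q ^ k * a))
    (fun k hk => h k (by linarith)) (summable_pow_mul hQ0 hQ1 a).norm
  simpa only [qPochInf, sub_eq_add_neg] using this

theorem qPochInf_pos (hQ0 : 0 ≤ Q) (hQ1 : Q < 1) {a : ℝ} (h : a < 1) : 0 < qPochInf a Q := by
  have h1 : ∀ k : ℕ, a * Q ^ k < 1 := fun k => by
    have h2 : Q ^ k ≤ 1 := pow_le_one₀ hQ0 hQ1.le
    have h3 : 0 ≤ Q ^ k := by positivity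
    rcases le_or_gt a 0 with ha | ha <;> nlinarith
  refine lt_of_le_of_ne ?_ (qPochInf_ne_zero hQ0 hQ1 fun k => (h1 k).ne).symm
  refine ge_of_tendsto' (tendsto_qPoch hQ0 hQ1 a) fun n => Finset.prod_nonneg fun k _ => ?_
  linarith [h1 k, mul_comm a (Q ^ k)]

theorem qPoch_pos (hQ0 : 0 ≤ Q) (hQ1 : Q < 1) {a : ℝ} (h : a < 1) (n : ℕ) : 0 < qPoch a Q n := by
  refine Finset.prod_pos fun k _ => ?_
  have h2 : Q ^ k ≤ 1 := pow_le_one₀ hQ0 hQ1.le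
  have h3 : 0 ≤ Q ^ k := by positivity
  rcases le_or_gt a 0 with ha | ha <;> nlinarith

theorem abs_qPoch_sub_one_le (hQ0 : 0 ≤ Q) (hQ1 : Q < 1) (a : ℝ) (n : ℕ) :
    |qPoch a Q n - 1| ≤ Real.exp (|a| / (1 - Q)) - 1 := by
  have h := Finset.norm_prod_one_add_sub_one_le (Finset.range n) (fun k : ℕ => -(Q ^ k * a))
  simp only [← sub_eq_add_neg, Real.norm_eq_abs, abs_neg, abs_mul, abs_pow, abs_of_nonneg hQ0]
    at h
  refine h.trans (sub_le_sub_right (Real.exp_le_exp.2 ?_) 1)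
  rw [← Finset.sum_mul, div_eq_inv_mul, ← tsum_geometric_of_lt_one hQ0 hQ1]
  exact mul_le_mul_of_nonneg_right ((summable_geometric_of_lt_one hQ0 hQ1).sum_le_tsum _
    fun _ _ => by positivity) (abs_nonneg a)

theorem abs_qPochInf_sub_one_le (hQ0 : 0 ≤ Q) (hQ1 : Q < 1) (a : ℝ) :
    |qPochInf a Q - 1| ≤ Real.exp (|a| / (1 - Q)) - 1 :=
  le_of_tendsto' ((tendsto_qPoch hQ0 hQ1 a).sub_const 1).abs
    fun n => abs_qPoch_sub_one_le hQ0 hQ1 a n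

theorem abs_qPoch_le (hQ0 : 0 ≤ Q) (hQ1 : Q < 1) {a A : ℝ} (h : |a| ≤ A) (n : ℕ) :
    |qPoch a Q n| ≤ Real.exp (A / (1 - Q)) := by
  have h1 := abs_qPoch_sub_one_le hQ0 hQ1 a n
  have h2 : Real.exp (|a| / (1 - Q)) ≤ Real.exp (A / (1 - Q)) := by
    have : 0 < 1 - Q := by linarith
    gcongr
  have h3 := abs_sub_abs_le_abs_sub (qPoch a Q n) 1
  rw [abs_one] at h3
  linarith

theorem abs_qPochInf_le (hQ0 : 0 ≤ Q) (hQ1 : Q < 1) {a A : ℝ} (h : |a| ≤ A) :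
    |qPochInf a Q| ≤ Real.exp (A / (1 - Q)) :=
  le_of_tendsto' (tendsto_qPoch hQ0 hQ1 a).abs fun n => abs_qPoch_le hQ0 hQ1 h n

theorem tendsto_qPochInf_zero (hQ0 : 0 ≤ Q) (hQ1 : Q < 1) {u : ℕ → ℝ}
    (hu : Tendsto u atTop (𝓝 0)) : Tendsto (fun n => qPochInf (u n) Q) atTop (𝓝 1) := by
  rw [tendsto_iff_norm_sub_tendsto_zero]
  have h : Tendsto (fun n => Real.exp (|u n| / (1 - Q)) - 1) atTop (𝓝 0) := by
    have h1 := (Real.continuous_exp.tendsto _).comp (hu.abs.div_const (1 - Q))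
    simpa [Function.comp_def] using h1.sub_const 1
  exact squeeze_zero (fun _ => norm_nonneg _) (fun n => abs_qPochInf_sub_one_le hQ0 hQ1 _) h

theorem one_sub_pow_le_qPoch (hQ0 : 0 ≤ Q) (hQ1 : Q < 1) (n : ℕ) :
    (1 - Q) ^ n ≤ qPoch Q Q n := by
  induction n with
  | zero => simp [qPoch_zero]
  | succ n ih =>
    rw [pow_succ, qPoch_succ]
    have h2 : Q ^ n ≤ 1 := pow_le_one₀ hQ0 hQ1.le
    have h3 : 0 ≤ Q ^ n := by positivity
    have h4 : 0 < 1 - Q := by linarith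
    refine mul_le_mul ih ?_ h4.le (qPoch_pos hQ0 hQ1 hQ1 n).le
    nlinarith

/-- The Gaussian factor beats any geometric growth; every dominated-convergence or summability
argument for the q-series below reduces to this one. -/
theorem summable_pow_triangle (hQ0 : 0 < Q) (hQ1 : Q < 1) {z : ℝ} (hz : 0 < z) :
    Summable fun n : ℕ => z ^ n * Q ^ (n * (n - 1) / 2) := by
  refine summable_of_ratio_test_tendsto_lt_one one_pos
    (Eventually.of_forall fun n => by positivity) (l := 0) (α := ℝ) ?_ |>.congr fun _ => rfl
  have h : (fun n : ℕ => ‖z ^ (n + 1) * Q ^ ((n + 1) * (n + 1 - 1) / 2)‖ /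
      ‖z ^ n * Q ^ (n * (n - 1) / 2)‖) = fun n => z * Q ^ n := by
    funext n
    rw [Nat.triangle_succ, Real.norm_of_nonneg (by positivity), Real.norm_of_nonneg (by positivity)]
    field_simp
    ring
  rw [h]
  simpa using (tendsto_pow_atTop_nhds_zero_of_lt_one hQ0.le hQ1).const_mul z

/-- The summand of the `₁φ₁`-series `∑ cⁿ Q^{n(n-1)/2} (bQ;Q)_n (-bcQ^{n+1};Q)_∞ / (Q;Q)_n`. -/
noncomputable def phi11Term (Q b c : ℝ) (n : ℕ) : ℝ :=
  c ^ n * Q ^ (n * (n - 1) / 2) * qPoch (b * Q) Q n * qPochInf (-(b * c * Q ^ (n + 1))) Q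
    / qPoch Q Q n

theorem abs_phi11Term_le (hQ0 : 0 < Q) (hQ1 : Q < 1) {b c B C : ℝ} (hb : |b| ≤ B) (hc : |c| ≤ C)
    (n : ℕ) : |phi11Term Q b c n| ≤ (C / (1 - Q)) ^ n * Q ^ (n * (n - 1) / 2) *
      (Real.exp (B / (1 - Q)) * Real.exp (B * C / (1 - Q))) := by
  have hQ2 : 0 < 1 - Q := by linarith
  have hB : 0 ≤ B := (abs_nonneg b).trans hb
  have hC : 0 ≤ C := (abs_nonneg c).trans hc
  have h1 : |qPoch (b * Q) Q n| ≤ Real.exp (B / (1 - Q)) := abs_qPoch_le hQ0.le hQ1 (by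
    rw [abs_mul, abs_of_pos hQ0]
    exact (mul_le_of_le_one_right (abs_nonneg b) hQ1.le).trans hb) n
  have h2 : |qPochInf (-(b * c * Q ^ (n + 1))) Q| ≤ Real.exp (B * C / (1 - Q)) :=
    abs_qPochInf_le hQ0.le hQ1 (by
      rw [abs_neg, abs_mul, abs_mul, abs_of_pos (pow_pos hQ0 _)]
      exact (mul_le_of_le_one_right (by positivity) (pow_le_one₀ hQ0.le hQ1.le)).trans
        (mul_le_mul hb hc (abs_nonneg c) hB))
  have h3 := one_sub_pow_le_qPoch hQ0.le hQ1 n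
  rw [phi11Term, abs_div, abs_mul, abs_mul, abs_mul, abs_of_pos (qPoch_pos hQ0.le hQ1 hQ1 n),
    abs_pow, abs_of_pos (pow_pos hQ0 (n * (n - 1) / 2)), div_pow]
  calc |c| ^ n * Q ^ (n * (n - 1) / 2) * |qPoch (b * Q) Q n|
        * |qPochInf (-(b * c * Q ^ (n + 1))) Q| / qPoch Q Q n
      ≤ C ^ n * Q ^ (n * (n - 1) / 2) * Real.exp (B / (1 - Q))
        * Real.exp (B * C / (1 - Q)) / (1 - Q) ^ n := by gcongr
    _ = _ := by ring

theorem summable_phi11Bound (hQ0 : 0 < Q) (hQ1 : Q < 1) {C : ℝ} (hC : 0 < C) (D : ℝ) :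
    Summable fun n : ℕ => (C / (1 - Q)) ^ n * Q ^ (n * (n - 1) / 2) * D :=
  (summable_pow_triangle hQ0 hQ1 (div_pos hC (by linarith))).mul_right D

theorem summable_phi11Term (hQ0 : 0 < Q) (hQ1 : Q < 1) (b c : ℝ) : Summable (phi11Term Q b c) :=
  Summable.of_norm_bounded (summable_phi11Bound hQ0 hQ1 (by positivity) _)
    (abs_phi11Term_le hQ0 hQ1 le_rfl (le_add_of_nonneg_right zero_le_one : |c| ≤ |c| + 1))

theorem qPochInf_neg_mul_pow (hQ0 : 0 < Q) (hQ1 : Q < 1) (x : ℝ) (n : ℕ) :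
    qPochInf (-(x * Q ^ n)) Q = (1 + x * Q ^ n) * qPochInf (-(x * Q ^ (n + 1))) Q := by
  rw [qPochInf_eq hQ0.le hQ1]
  ring_nf

/-- The identity holds termwise once the terms of the last series are shifted by one index; the
shift does not change its sum. -/
theorem phi11Term_sub_tsum (hQ0 : 0 < Q) (hQ1 : Q < 1) (b c : ℝ) :
    ∑' n, phi11Term Q b c n - ∑' n, phi11Term Q (b * Q) c n =
      b * c * Q * (∑' n, phi11Term Q b (c * Q) n - ∑' n, phi11Term Q (b * Q) (c * Q) n) := by
  have hs := summable_phi11Term hQ0 hQ1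
  have hz : ∀ n, phi11Term Q b c n - phi11Term Q (b * Q) c n =
      b * c * Q * phi11Term Q b (c * Q) n -
        (if n = 0 then 0 else b * c * Q * phi11Term Q (b * Q) (c * Q) (n - 1)) := by
    intro n
    rcases n with _ | n
    · simp only [phi11Term, if_true, qPoch_zero, pow_zero, one_mul, zero_mul, Nat.zero_div]
      rw [show -(b * c * Q ^ (0 + 1)) = -(b * c * Q ^ 1) by ring, qPochInf_neg_mul_pow hQ0 hQ1,
        show -(b * Q * c * Q ^ (0 + 1)) = -(b * c * Q ^ (1 + 1)) by ring,
        show -(b * (c * Q) * Q ^ (0 + 1)) = -(b * c * Q ^ (1 + 1)) by ring]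
      ring
    · have hp := (qPoch_pos hQ0.le hQ1 hQ1 n).ne'
      have hp' := (qPoch_pos hQ0.le hQ1 hQ1 (n + 1)).ne'
      rw [qPoch_succ] at hp'
      have hp2 := right_ne_zero_of_mul hp'
      simp only [phi11Term, Nat.succ_ne_zero, if_false, Nat.add_sub_cancel]
      rw [triangle_succ', qPoch_succ Q Q, qPoch_succ' (b * Q), qPoch_succ (b * Q * Q),
        qPochInf_neg_mul_pow hQ0 hQ1,
        show -(b * Q * c * Q ^ (n + 1 + 1)) = -(b * c * Q ^ (n + 1 + 1 + 1)) by ring,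
        show -(b * (c * Q) * Q ^ (n + 1 + 1)) = -(b * c * Q ^ (n + 1 + 1 + 1)) by ring,
        show -(b * Q * (c * Q) * Q ^ (n + 1)) = -(b * c * Q ^ (n + 1 + 1 + 1)) by ring]
      generalize qPochInf (-(b * c * Q ^ (n + 1 + 1 + 1))) Q = V
      simp only [pow_add, mul_pow, pow_one]
      generalize Q ^ n = X at *
      have hp3 : 1 - Q * X ≠ 0 := by rwa [mul_comm]
      field_simp
      ring
  have h2 : Summable fun n => if n = 0 then 0 else b * c * Q * phi11Term Q (b * Q) (c * Q) (n - 1) := by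
    rw [← summable_nat_add_iff 1]
    simpa using (hs (b * Q) (c * Q)).mul_left (b * c * Q)
  rw [← (hs b c).tsum_sub (hs (b * Q) c), tsum_congr hz,
    ((hs b (c * Q)).mul_left (b * c * Q)).tsum_sub h2, tsum_mul_left, h2.tsum_eq_zero_add]
  simp [tsum_mul_left, mul_sub]

theorem abs_tsum_phi11Term_le (hQ0 : 0 < Q) (hQ1 : Q < 1) {b c B C : ℝ} (hC0 : 0 < C)
    (hb : |b| ≤ B) (hc : |c| ≤ C) :
    |∑' n, phi11Term Q b c n| ≤ ∑' n : ℕ, (C / (1 - Q)) ^ n * Q ^ (n * (n - 1) / 2) *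
      (Real.exp (B / (1 - Q)) * Real.exp (B * C / (1 - Q))) :=
  tsum_of_norm_bounded (f := phi11Term Q b c) (summable_phi11Bound hQ0 hQ1 hC0
    (Real.exp (B / (1 - Q)) * Real.exp (B * C / (1 - Q)))).hasSum
    (abs_phi11Term_le hQ0 hQ1 hb hc)

/-- The difference of the two sums at c Q^k is a bounded sequence `E`, and `E k` is a multiple of `E
(k + 1)` by a factor tending to zero. Hence `E` vanishes for large k, and then for all k by
descending. -/
theorem tsum_phi11Term_mul (hQ0 : 0 < Q) (hQ1 : Q < 1) (b c : ℝ) :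
    ∑' n, phi11Term Q (b * Q) c n = ∑' n, phi11Term Q b c n := by
  set E : ℕ → ℝ := fun k =>
    ∑' n, phi11Term Q b (c * Q ^ k) n - ∑' n, phi11Term Q (b * Q) (c * Q ^ k) n with hE
  have hstep : ∀ k, E k = b * c * Q * Q ^ k * E (k + 1) := fun k => by
    simp only [hE]
    rw [phi11Term_sub_tsum hQ0 hQ1]
    ring_nf
  set M := ∑' n : ℕ, ((|c| + 1) / (1 - Q)) ^ n * Q ^ (n * (n - 1) / 2) *
      (Real.exp (|b| / (1 - Q)) * Real.exp (|b| * (|c| + 1) / (1 - Q)))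
  have hbound : ∀ k, |E k| ≤ M + M := fun k => by
    have hc : |c * Q ^ k| ≤ |c| + 1 := by
      rw [abs_mul, abs_of_pos (pow_pos hQ0 _)]
      have := mul_le_of_le_one_right (abs_nonneg c) (pow_le_one₀ hQ0.le hQ1.le : Q ^ k ≤ 1)
      linarith
    have hb : |b * Q| ≤ |b| := by
      rw [abs_mul, abs_of_pos hQ0]
      exact mul_le_of_le_one_right (abs_nonneg b) hQ1.le
    exact (abs_sub _ _).trans (add_le_add
      (abs_tsum_phi11Term_le hQ0 hQ1 (by positivity) le_rfl hc)
      (abs_tsum_phi11Term_le hQ0 hQ1 (by positivity) hb hc))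
  obtain ⟨K, hK⟩ : ∃ K, ∀ k ≥ K, E k = 0 := by
    have hlim2 : Tendsto (fun k : ℕ => |b * c * Q| * Q ^ k) atTop (𝓝 0) := by
      simpa using (tendsto_pow_atTop_nhds_zero_of_lt_one hQ0.le hQ1).const_mul |b * c * Q|
    obtain ⟨K, hK⟩ := eventually_atTop.1 (hlim2.eventually (gt_mem_nhds (by norm_num : (0:ℝ) < 1/2)))
    -- From K on the factor is below 1/2, so each use of `hstep` halves the uniform bound.
    have hind : ∀ j, ∀ k ≥ K, |E k| ≤ (1 / 2) ^ j * (M + M) := by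
      intro j
      induction j with
      | zero => intro k _; simpa using hbound k
      | succ j ih =>
        intro k hk
        rw [hstep, abs_mul, abs_mul (b * c * Q), abs_of_pos (pow_pos hQ0 k), pow_succ]
        calc _ ≤ 1 / 2 * ((1 / 2) ^ j * (M + M)) :=
              mul_le_mul (hK k hk).le (ih _ (by omega)) (abs_nonneg _) (by norm_num)
          _ = _ := by ring
    refine ⟨K, fun k hk => abs_nonpos_iff.1 ?_⟩
    have : Tendsto (fun j : ℕ => (1 / 2 : ℝ) ^ j * (M + M)) atTop (𝓝 0) := by
      simpa using (tendsto_pow_atTop_nhds_zero_of_lt_one (by norm_num : (0:ℝ) ≤ 1/2)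
        (by norm_num)).mul_const (M + M)
    exact ge_of_tendsto' this fun j => hind j k hk
  have hdown : ∀ k, E k = 0 := by
    intro k
    obtain ⟨d, hd⟩ : ∃ d, k + d ≥ K := ⟨K, by omega⟩
    induction d generalizing k with
    | zero => exact hK k hd
    | succ d ih => rw [hstep, ih (k + 1) (by omega), mul_zero]
  have := hdown 0
  simp only [hE, pow_zero, mul_one] at this
  linarith

/-- Termwise, the two sides differ by c (1 - bQ) times the difference of the series for bQ and for b
at cQ, up to an index shift, and that difference sums to zero by `tsum_phi11Term_mul`. -/
theorem tsum_phi11Term_eq_mul (hQ0 : 0 < Q) (hQ1 : Q < 1) (b c : ℝ) :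
    ∑' n, phi11Term Q b c n = (1 + c) * ∑' n, phi11Term Q b (c * Q) n := by
  have hs := summable_phi11Term hQ0 hQ1
  have hz : ∀ n, phi11Term Q b c n - (1 + c) * phi11Term Q b (c * Q) n =
      (if n = 0 then 0 else c * (1 - b * Q) * phi11Term Q (b * Q) (c * Q) (n - 1)) -
      c * (1 - b * Q) * phi11Term Q b (c * Q) n := by
    intro n
    rcases n with _ | n
    · simp only [phi11Term, if_true, qPoch_zero, pow_zero, one_mul, zero_mul, Nat.zero_div]
      rw [show -(b * c * Q ^ (0 + 1)) = -(b * c * Q ^ 1) by ring, qPochInf_neg_mul_pow hQ0 hQ1,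
        show -(b * (c * Q) * Q ^ (0 + 1)) = -(b * c * Q ^ (1 + 1)) by ring]
      ring
    · have hp := (qPoch_pos hQ0.le hQ1 hQ1 n).ne'
      have hp' := (qPoch_pos hQ0.le hQ1 hQ1 (n + 1)).ne'
      rw [qPoch_succ] at hp'
      have hp2 := right_ne_zero_of_mul hp'
      simp only [phi11Term, Nat.succ_ne_zero, if_false, Nat.add_sub_cancel]
      rw [triangle_succ', qPoch_succ Q Q, qPoch_succ' (b * Q),
        qPochInf_neg_mul_pow hQ0 hQ1,
        show -(b * (c * Q) * Q ^ (n + 1 + 1)) = -(b * c * Q ^ (n + 1 + 1 + 1)) by ring,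
        show -(b * Q * (c * Q) * Q ^ (n + 1)) = -(b * c * Q ^ (n + 1 + 1 + 1)) by ring]
      generalize qPochInf (-(b * c * Q ^ (n + 1 + 1 + 1))) Q = V
      simp only [pow_add, mul_pow, pow_one]
      generalize Q ^ n = X at *
      have hp3 : 1 - Q * X ≠ 0 := by rwa [mul_comm]
      field_simp
      ring
  have h2 : Summable fun n => if n = 0 then 0 else
      c * (1 - b * Q) * phi11Term Q (b * Q) (c * Q) (n - 1) := by
    rw [← summable_nat_add_iff 1]
    simpa using (hs (b * Q) (c * Q)).mul_left (c * (1 - b * Q))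
  have h3 : ∑' n, phi11Term Q b c n - (1 + c) * ∑' n, phi11Term Q b (c * Q) n = 0 := by
    rw [← tsum_mul_left, ← (hs b c).tsum_sub ((hs b (c * Q)).mul_left _), tsum_congr hz,
      h2.tsum_sub ((hs b (c * Q)).mul_left _), tsum_mul_left, h2.tsum_eq_zero_add]
    simp [tsum_mul_left, tsum_phi11Term_mul hQ0 hQ1]
  linarith

/-- The `q`-analogue of Gauss' theorem for `₁φ₁`, in a form without denominators in `b`. -/
theorem hasSum_phi11Term (hQ0 : 0 < Q) (hQ1 : Q < 1) (b c : ℝ) :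
    HasSum (phi11Term Q b c) (qPochInf (-c) Q) := by
  have hpow : Tendsto (fun k : ℕ => Q ^ k) atTop (𝓝 0) :=
    tendsto_pow_atTop_nhds_zero_of_lt_one hQ0.le hQ1
  have hiter : ∀ k : ℕ, ∑' n, phi11Term Q b c n =
      qPoch (-c) Q k * ∑' n, phi11Term Q b (c * Q ^ k) n := by
    intro k
    induction k with
    | zero => simp [qPoch_zero]
    | succ k ih =>
      rw [ih, tsum_phi11Term_eq_mul hQ0 hQ1, qPoch_succ]
      ring_nf
  -- As c Q^k tends to 0, only the term n = 0 survives.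
  have hlim : Tendsto (fun k : ℕ => ∑' n, phi11Term Q b (c * Q ^ k) n) atTop
      (𝓝 (∑' n : ℕ, if n = 0 then 1 else 0)) := by
    refine tendsto_tsum_of_dominated_convergence
      (summable_phi11Bound hQ0 hQ1 (C := |c| + 1) (by positivity)
        (Real.exp (|b| / (1 - Q)) * Real.exp (|b| * (|c| + 1) / (1 - Q)))) ?_ ?_
    · intro n
      have hinf : Tendsto (fun k : ℕ => qPochInf (-(b * (c * Q ^ k) * Q ^ (n + 1))) Q) atTop
          (𝓝 1) := by
        refine tendsto_qPochInf_zero hQ0.le hQ1 ?_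
        have := (hpow.const_mul (b * c * Q ^ (n + 1))).neg
        rw [mul_zero, neg_zero] at this
        exact this.congr fun k => by ring
      rcases n with _ | n
      · simpa [phi11Term, qPoch_zero] using hinf
      · have h1 : Tendsto (fun k : ℕ => (c * Q ^ k) ^ (n + 1)) atTop (𝓝 0) := by
          simpa using (hpow.const_mul c).pow (n + 1)
        have := ((((h1.mul_const (Q ^ ((n + 1) * (n + 1 - 1) / 2))).mul_const
          (qPoch (b * Q) Q (n + 1))).mul hinf).div_const (qPoch Q Q (n + 1)))
        simpa [phi11Term] using this
    · refine Eventually.of_forall fun k n => abs_phi11Term_le hQ0 hQ1 le_rfl ?_ n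
      rw [abs_mul, abs_of_pos (pow_pos hQ0 _)]
      have := mul_le_of_le_one_right (abs_nonneg c) (pow_le_one₀ hQ0.le hQ1.le : Q ^ k ≤ 1)
      linarith
  rw [tsum_ite_eq] at hlim
  have hend := (tendsto_qPoch hQ0.le hQ1 (-c)).mul hlim
  rw [mul_one] at hend
  have : ∑' n, phi11Term Q b c n = qPochInf (-c) Q :=
    tendsto_nhds_unique (tendsto_const_nhds.congr hiter) hend
  exact this ▸ (summable_phi11Term hQ0 hQ1 b c).hasSum

end QSeries

/-! ### q-Meixner polynomials: shift relations, difference equation, norms, hypergeometric form. -/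

section Meixner

open Filter Topology

variable {Q : ℝ}

/-- The `q`-Meixner polynomials `(bQ;Q)_n ₂φ₁(Q^{-n}, Q^{-r}; bQ; Q, -Q^{r+1}/c)`, generated from
`(bQ;Q)_n` by the backward shift in the degree `r`. -/
noncomputable def meixner (Q : ℝ) : ℕ → ℝ → ℝ → ℕ → ℝ
  | 0, b, _, n => qPoch (b * Q) Q n
  | r + 1, b, c, n => meixner Q r (b * Q) (c / Q) n -
      Q / c * ((Q ^ n)⁻¹ - 1) * (1 + b * c * Q ^ n) * meixner Q r (b * Q) (c / Q) (n - 1)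

/-- Degree-lowering companion of the recursion that defines `meixner`. For r = 0 the truncated `r -
1` is harmless because of the factor 1 - Q^r. In the recursion `n - 1` at n = 0 is harmless too,
since (Q^n)⁻¹ - 1 vanishes there. -/
theorem meixner_forward (hQ0 : 0 < Q) (r : ℕ) (b : ℝ) {c : ℝ} (hc : c ≠ 0) (n : ℕ) :
    (1 - b * Q ^ (n + 1)) * meixner Q r b c n - meixner Q r b c (n + 1) =
      (1 - Q ^ r) / (c * Q ^ n) * meixner Q (r - 1) (b * Q) (c / Q) n := by
  have hQ := hQ0.ne'
  induction r generalizing b c n with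
  | zero =>
    simp only [meixner, qPoch_succ, pow_zero, sub_self, zero_div, zero_mul]
    ring
  | succ r ih =>
    have hc' : c / Q ≠ 0 := div_ne_zero hc hQ
    -- The factor 1 - Q^r lets the defining recursion cover r = 0 as well.
    have hback : (1 - Q ^ r) * meixner Q r (b * Q) (c / Q) n =
        (1 - Q ^ r) * (meixner Q (r - 1) (b * Q * Q) (c / Q / Q) n -
          Q / (c / Q) * ((Q ^ n)⁻¹ - 1) * (1 + b * Q * (c / Q) * Q ^ n) *
            meixner Q (r - 1) (b * Q * Q) (c / Q / Q) (n - 1)) := by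
      rcases r with _ | r
      · simp
      · rfl
    have h1 := ih (b * Q) hc' n
    simp only [meixner, Nat.add_sub_cancel]
    rcases n with _ | n
    · simp only [pow_zero, inv_one, sub_self, mul_zero, zero_mul, sub_zero, zero_add, pow_one,
        mul_one] at hback h1 ⊢
      field_simp at hback h1 ⊢
      linear_combination h1 - Q * hback
    · have h2 := ih (b * Q) hc' n
      simp only [Nat.add_sub_cancel] at hback ⊢
      generalize meixner Q r (b * Q) (c / Q) (n + 1 + 1) = u2 at *
      generalize meixner Q r (b * Q) (c / Q) (n + 1) = u1 at *
      generalize meixner Q r (b * Q) (c / Q) n = u0 at *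
      generalize meixner Q (r - 1) (b * Q * Q) (c / Q / Q) (n + 1) = v1 at *
      generalize meixner Q (r - 1) (b * Q * Q) (c / Q / Q) n = v0 at *
      have hX : Q ^ n ≠ 0 := pow_ne_zero _ hQ
      simp only [pow_succ] at *
      generalize Q ^ n = X at *
      generalize Q ^ r = R at *
      -- The induction hypothesis at two neighbouring points, together with `hback`, expresses
      -- everything through u0 and u1; a rational identity remains.
      have e1 : u2 = (1 - b * Q * (X * Q * Q)) * u1 - (1 - R) / (c / Q * (X * Q)) * v1 := by
        linear_combination -h1
      have e2 : (1 - R) * v1 = (1 - R) * u1 + (1 - R) * (Q / (c / Q) * ((X * Q)⁻¹ - 1) *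
        (1 + b * Q * (c / Q) * (X * Q)) * v0) := by linear_combination -hback
      have e3 : (1 - R) * v0 = (c / Q * X) * ((1 - b * Q * (X * Q)) * u0 - u1) := by
        rw [h2]; field_simp
      have e4 : (1 - R) / (c / Q * (X * Q)) * v1 = (1 / (c / Q * (X * Q))) *
          ((1 - R) * u1 + (Q / (c / Q) * ((X * Q)⁻¹ - 1) *
        (1 + b * Q * (c / Q) * (X * Q)) * ((c / Q * X) * ((1 - b * Q * (X * Q)) * u0 - u1)))) := by
        rw [← e3]
        linear_combination (1 / (c / Q * (X * Q))) * e2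
      rw [e1, e4]
      field_simp
      ring

/-- The second order `q`-difference equation of the `q`-Meixner polynomials. -/
theorem meixner_difference (hQ0 : 0 < Q) (r : ℕ) (b : ℝ) {c : ℝ} (hc : c ≠ 0) (n : ℕ) :
    c * Q ^ n * ((1 - b * Q ^ (n + 1)) * meixner Q r b c n - meixner Q r b c (n + 1)) -
      (1 - Q ^ n) * (1 + b * c * Q ^ n) *
        ((1 - b * Q ^ n) * meixner Q r b c (n - 1) - meixner Q r b c n) =
      (1 - Q ^ r) * meixner Q r b c n := by
  have hQ := hQ0.ne'
  have hX : Q ^ n ≠ 0 := pow_ne_zero _ hQ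
  -- The difference operator is the forward shift followed by the backward shift, and the latter is
  -- the definition of `meixner`.
  rw [meixner_forward hQ0 r b hc n]
  rcases r with _ | r
  · rcases n with _ | n
    · simp
    · have := meixner_forward hQ0 0 b hc n
      simp only [pow_zero, sub_self, zero_div, zero_mul] at this
      simp [this]
  · rcases n with _ | n
    · simp only [Nat.add_sub_cancel, meixner, pow_zero, sub_self, zero_mul, inv_one, mul_zero]
      field_simp
      ring
    · have := meixner_forward hQ0 (r + 1) b hc n
      simp only [Nat.add_sub_cancel] at this ⊢
      rw [this]
      simp only [meixner, Nat.add_sub_cancel]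
      have hX : Q ^ n ≠ 0 := pow_ne_zero _ hQ
      simp only [pow_succ] at *
      generalize Q ^ n = X at *
      field_simp

/-- A crude geometric bound, needed only to sum against the Gaussian decay of `meixnerWeight`. -/
theorem meixner_bound (hQ0 : 0 < Q) (hQ1 : Q < 1) (r : ℕ) (b c : ℝ) :
    ∃ C z : ℝ, 0 < C ∧ 1 ≤ z ∧ ∀ n, |meixner Q r b c n| ≤ C * z ^ n := by
  induction r generalizing b c with
  | zero =>
    exact ⟨Real.exp (|b * Q| / (1 - Q)), 1, by positivity, le_rfl, fun n => by
      rw [one_pow, mul_one]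
      exact abs_qPoch_le hQ0.le hQ1 le_rfl n⟩
  | succ r ih =>
    obtain ⟨C, z, hC, hz, h⟩ := ih (b * Q) (c / Q)
    refine ⟨C * (1 + Q / |c| * (1 + |b * c|)), z / Q, by positivity,
      (one_le_div hQ0).2 (hQ1.le.trans hz), fun n => ?_⟩
    have hX : 0 < Q ^ n := by positivity
    have hX1 : Q ^ n ≤ 1 := pow_le_one₀ hQ0.le hQ1.le
    have hI : 1 ≤ (Q ^ n)⁻¹ := (one_le_inv₀ hX).2 hX1
    have h0 : |meixner Q r (b * Q) (c / Q) n| ≤ C * z ^ n * (Q ^ n)⁻¹ :=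
      (h n).trans (le_mul_of_one_le_right (by positivity) hI)
    have h1 : |meixner Q r (b * Q) (c / Q) (n - 1)| ≤ C * z ^ n :=
      (h (n - 1)).trans (mul_le_mul_of_nonneg_left (pow_le_pow_right₀ hz (Nat.sub_le n 1)) hC.le)
    have h2 : |(Q ^ n)⁻¹ - 1| ≤ (Q ^ n)⁻¹ := by
      rw [abs_of_nonneg (by linarith)]; linarith
    have h3 : |1 + b * c * Q ^ n| ≤ 1 + |b * c| := by
      refine (abs_add_le _ _).trans ?_
      rw [abs_one, abs_mul (b * c), abs_of_pos hX]
      linarith [mul_le_of_le_one_right (abs_nonneg (b * c)) hX1]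
    calc |meixner Q (r + 1) b c n|
        ≤ |meixner Q r (b * Q) (c / Q) n| + |Q / c * ((Q ^ n)⁻¹ - 1) * (1 + b * c * Q ^ n) *
            meixner Q r (b * Q) (c / Q) (n - 1)| := abs_sub _ _
      _ ≤ C * z ^ n * (Q ^ n)⁻¹ + Q / |c| * (Q ^ n)⁻¹ * (1 + |b * c|) * (C * z ^ n) := by
          rw [abs_mul, abs_mul, abs_mul, abs_div, abs_of_pos hQ0]
          gcongr
      _ = C * (1 + Q / |c| * (1 + |b * c|)) * (z / Q) ^ n := by
          rw [div_pow, div_eq_mul_inv]; ring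

/-- The weight for which the `q`-Meixner polynomials are orthogonal. -/
noncomputable def meixnerWeight (Q b c : ℝ) (n : ℕ) : ℝ :=
  c ^ n * Q ^ (n * (n - 1) / 2) * qPochInf (-(b * c * Q ^ (n + 1))) Q * qPochInf (b * Q ^ (n + 1)) Q
    / qPoch Q Q n

theorem abs_meixnerWeight_le (hQ0 : 0 < Q) (hQ1 : Q < 1) (b c : ℝ) (n : ℕ) :
    |meixnerWeight Q b c n| ≤ (Real.exp (|b * c| / (1 - Q)) * Real.exp (|b| / (1 - Q))) *
      ((|c| / (1 - Q)) ^ n * Q ^ (n * (n - 1) / 2)) := by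
  have hQ2 : 0 < 1 - Q := by linarith
  have h1 : |qPochInf (-(b * c * Q ^ (n + 1))) Q| ≤ Real.exp (|b * c| / (1 - Q)) :=
    abs_qPochInf_le hQ0.le hQ1 (by
      rw [abs_neg, abs_mul (b * c), abs_of_pos (pow_pos hQ0 _)]
      exact mul_le_of_le_one_right (abs_nonneg _) (pow_le_one₀ hQ0.le hQ1.le))
  have h2 : |qPochInf (b * Q ^ (n + 1)) Q| ≤ Real.exp (|b| / (1 - Q)) :=
    abs_qPochInf_le hQ0.le hQ1 (by
      rw [abs_mul, abs_of_pos (pow_pos hQ0 _)]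
      exact mul_le_of_le_one_right (abs_nonneg _) (pow_le_one₀ hQ0.le hQ1.le))
  have h3 := one_sub_pow_le_qPoch hQ0.le hQ1 n
  rw [meixnerWeight, abs_div, abs_mul, abs_mul, abs_mul, abs_of_pos (qPoch_pos hQ0.le hQ1 hQ1 n),
    abs_pow, abs_of_pos (pow_pos hQ0 (n * (n - 1) / 2)), div_pow]
  calc |c| ^ n * Q ^ (n * (n - 1) / 2) * |qPochInf (-(b * c * Q ^ (n + 1))) Q|
        * |qPochInf (b * Q ^ (n + 1)) Q| / qPoch Q Q n
      ≤ |c| ^ n * Q ^ (n * (n - 1) / 2) * Real.exp (|b * c| / (1 - Q))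
        * Real.exp (|b| / (1 - Q)) / (1 - Q) ^ n := by gcongr
    _ = _ := by ring

/-- With `meixnerWeight_succ`, this is the change of weight under b ↦ bQ, c ↦ c/Q that makes the two
shifts adjoint to each other. The product bc is unchanged. -/
theorem meixnerWeight_eq (hQ0 : 0 < Q) (hQ1 : Q < 1) (b c : ℝ) (n : ℕ) :
    meixnerWeight Q b c n =
      Q ^ n * (1 - b * Q ^ (n + 1)) * meixnerWeight Q (b * Q) (c / Q) n := by
  have hQ := hQ0.ne'
  rw [meixnerWeight, meixnerWeight, qPochInf_eq hQ0.le hQ1 (b * Q ^ (n + 1)),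
    show b * Q * (c / Q) * Q ^ (n + 1) = b * c * Q ^ (n + 1) by field_simp,
    show b * Q * Q ^ (n + 1) = b * Q ^ (n + 1) * Q by ring, div_pow]
  field_simp

theorem meixnerWeight_succ (hQ0 : 0 < Q) (hQ1 : Q < 1) (b c : ℝ) (n : ℕ) :
    meixnerWeight Q b c (n + 1) * (1 - Q ^ (n + 1)) * (1 + b * c * Q ^ (n + 1)) =
      c * Q ^ n * Q ^ n * meixnerWeight Q (b * Q) (c / Q) n := by
  have hQ := hQ0.ne'
  have hp := (qPoch_pos hQ0.le hQ1 hQ1 (n + 1)).ne'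
  have hp1 := (qPoch_pos hQ0.le hQ1 hQ1 n).ne'
  rw [qPoch_succ, ← pow_succ] at hp
  have hp2 := right_ne_zero_of_mul hp
  have h := qPochInf_neg_mul_pow hQ0 hQ1 (b * c) (n + 1)
  rw [meixnerWeight, meixnerWeight, Nat.triangle_succ,
    show b * Q * (c / Q) * Q ^ (n + 1) = b * c * Q ^ (n + 1) by field_simp,
    show b * Q * Q ^ (n + 1) = b * Q ^ (n + 1 + 1) by ring, h, div_pow, qPoch_succ, ← pow_succ,
    pow_add Q]
  generalize qPochInf (-(b * c * Q ^ (n + 1 + 1))) Q = V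
  generalize qPochInf (b * Q ^ (n + 1 + 1)) Q = V'
  generalize Q ^ (n + 1) = Y at *
  field_simp
  ring

/-- The squared norm of the `q`-Meixner polynomials. -/
theorem hasSum_meixner_sq (hQ0 : 0 < Q) (hQ1 : Q < 1) (r : ℕ) (b : ℝ) {c : ℝ} (hc : c ≠ 0) :
    HasSum (fun n => meixnerWeight Q b c n * meixner Q r b c n ^ 2)
      (qPoch Q Q r * qPoch (-(Q / c)) Q r / Q ^ r * qPochInf (b * Q ^ (r + 1)) Q
        * qPochInf (-c) Q) := by
  have hQ := hQ0.ne'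
  induction r generalizing b c with
  | zero =>
    have h := (hasSum_phi11Term hQ0 hQ1 b c).mul_left (qPochInf (b * Q ^ (0 + 1)) Q)
    simp only [qPoch_zero, pow_zero, one_mul, div_one]
    refine h.congr_fun ?_
    intro n
    have h1 := qPochInf_eq_qPoch_mul hQ0.le hQ1 (b * Q) n
    rw [meixnerWeight, phi11Term, meixner, zero_add, pow_one, h1,
      show b * Q ^ (n + 1) = b * Q * Q ^ n by ring]
    ring
  | succ r ih =>
    have hc' : c / Q ≠ 0 := div_ne_zero hc hQ
    -- Boundary term of the summation by parts. Expanding one of the two factors `meixner Q (r + 1)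
    -- b c n` by its definition gives τ(n+1) - τ(n) plus a multiple of the summand for degree r.
    set τ : ℕ → ℝ := fun n => if n = 0 then 0 else Q ^ (n - 1) *
      meixnerWeight Q (b * Q) (c / Q) (n - 1) * meixner Q (r + 1) b c n *
        meixner Q r (b * Q) (c / Q) (n - 1) with hτ
    have hτs : Summable τ := by
      rw [← summable_nat_add_iff 1]
      simp only [hτ, Nat.succ_ne_zero, if_false, Nat.add_sub_cancel]
      obtain ⟨C, z, hC, hz, h⟩ := meixner_bound hQ0 hQ1 (r + 1) b c
      obtain ⟨C', z', hC', hz', h'⟩ := meixner_bound hQ0 hQ1 r (b * Q) (c / Q)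
      have hQ2 : 0 < 1 - Q := by linarith
      have hcp : 0 < |c / Q| := abs_pos.2 hc'
      refine Summable.of_norm_bounded ((summable_pow_triangle hQ0 hQ1
        (z := |c / Q| / (1 - Q) * z * z') (by positivity)).mul_left
        ((Real.exp (|b * Q * (c / Q)| / (1 - Q)) * Real.exp (|b * Q| / (1 - Q))) * (C * z) * C'))
        fun n => ?_
      rw [Real.norm_eq_abs, abs_mul, abs_mul, abs_mul, abs_of_pos (pow_pos hQ0 n)]
      calc Q ^ n * |meixnerWeight Q (b * Q) (c / Q) n| * |meixner Q (r + 1) b c (n + 1)| *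
            |meixner Q r (b * Q) (c / Q) n|
          ≤ 1 * ((Real.exp (|b * Q * (c / Q)| / (1 - Q)) * Real.exp (|b * Q| / (1 - Q))) *
            ((|c / Q| / (1 - Q)) ^ n * Q ^ (n * (n - 1) / 2))) * (C * z ^ (n + 1)) *
            (C' * z' ^ n) := by
            gcongr
            · exact pow_le_one₀ hQ0.le hQ1.le
            · exact abs_meixnerWeight_le hQ0 hQ1 _ _ _
            · exact h _
            · exact h' _
        _ = _ := by rw [mul_pow, mul_pow]; ring
    have hτ' : HasSum (fun n => τ (n + 1) - τ n) 0 := by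
      have h1 := (hasSum_nat_add_iff' 1).2 hτs.hasSum
      have h2 := h1.sub hτs.hasSum
      simpa [hτ] using h2
    have h := ((ih (b * Q) hc').mul_left ((1 - Q ^ (r + 1)) / c)).add hτ'
    have hval : qPoch Q Q (r + 1) * qPoch (-(Q / c)) Q (r + 1) / Q ^ (r + 1) *
        qPochInf (b * Q ^ (r + 1 + 1)) Q * qPochInf (-c) Q =
      (1 - Q ^ (r + 1)) / c * (qPoch Q Q r * qPoch (-(Q / (c / Q))) Q r / Q ^ r *
        qPochInf (b * Q * Q ^ (r + 1)) Q * qPochInf (-(c / Q)) Q) + 0 := by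
      rw [qPoch_succ, qPoch_succ' (-(Q / c)), qPochInf_eq hQ0.le hQ1 (-(c / Q)),
        show -(c / Q) * Q = -c by field_simp, show -(Q / (c / Q)) = -(Q / c) * Q by field_simp,
        show b * Q * Q ^ (r + 1) = b * Q ^ (r + 1 + 1) by ring]
      field_simp
      ring
    rw [hval]
    refine h.congr_fun ?_
    intro n
    have hX : Q ^ n ≠ 0 := pow_ne_zero _ hQ
    have hf := meixner_forward hQ0 (r + 1) b hc n
    have hb : meixner Q (r + 1) b c n = meixner Q r (b * Q) (c / Q) n -
      Q / c * ((Q ^ n)⁻¹ - 1) * (1 + b * c * Q ^ n) * meixner Q r (b * Q) (c / Q) (n - 1) := rfl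
    simp only [Nat.add_sub_cancel] at hf
    have e1 : meixnerWeight Q b c n * meixner Q (r + 1) b c n * meixner Q r (b * Q) (c / Q) n =
        τ (n + 1) + (1 - Q ^ (r + 1)) / c *
          (meixnerWeight Q (b * Q) (c / Q) n * meixner Q r (b * Q) (c / Q) n ^ 2) := by
      simp only [hτ, Nat.succ_ne_zero, if_false, Nat.add_sub_cancel]
      rw [meixnerWeight_eq hQ0 hQ1]
      have : (1 - b * Q ^ (n + 1)) * meixner Q (r + 1) b c n = meixner Q (r + 1) b c (n + 1) +
        (1 - Q ^ (r + 1)) / (c * Q ^ n) * meixner Q r (b * Q) (c / Q) n := by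
        linear_combination hf
      have e : Q ^ n * ((1 - Q ^ (r + 1)) / (c * Q ^ n)) = (1 - Q ^ (r + 1)) / c := by
        field_simp
      linear_combination (Q ^ n * meixnerWeight Q (b * Q) (c / Q) n *
        meixner Q r (b * Q) (c / Q) n) * this + (meixnerWeight Q (b * Q) (c / Q) n *
        meixner Q r (b * Q) (c / Q) n ^ 2) * e
    have e2 : meixnerWeight Q b c n * meixner Q (r + 1) b c n *
        (Q / c * ((Q ^ n)⁻¹ - 1) * (1 + b * c * Q ^ n) * meixner Q r (b * Q) (c / Q) (n - 1)) =
        τ n := by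
      rcases n with _ | n
      · simp [hτ]
      · simp only [hτ, Nat.succ_ne_zero, if_false, Nat.add_sub_cancel]
        have hw := meixnerWeight_succ hQ0 hQ1 b c n
        have e : Q / c * ((Q ^ (n + 1))⁻¹ - 1) = (1 - Q ^ (n + 1)) * (c * Q ^ n)⁻¹ := by
          field_simp
          ring
        have e' : Q ^ n * Q ^ n * c * (c * Q ^ n)⁻¹ = Q ^ n := by field_simp
        rw [e]
        linear_combination ((c * Q ^ n)⁻¹ * meixner Q (r + 1) b c (n + 1) *
          meixner Q r (b * Q) (c / Q) n) * hw + (meixnerWeight Q (b * Q) (c / Q) n *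
          meixner Q (r + 1) b c (n + 1) * meixner Q r (b * Q) (c / Q) n) * e'
    calc meixnerWeight Q b c n * meixner Q (r + 1) b c n ^ 2
        = meixnerWeight Q b c n * meixner Q (r + 1) b c n * meixner Q r (b * Q) (c / Q) n -
          meixnerWeight Q b c n * meixner Q (r + 1) b c n *
        (Q / c * ((Q ^ n)⁻¹ - 1) * (1 + b * c * Q ^ n) * meixner Q r (b * Q) (c / Q) (n - 1)) := by
          rw [← mul_sub, ← hb]; ring
      _ = _ := by rw [e1, e2]; ring

/-- The q-Pascal rule that matches the backward shift in `meixner_eq_sum`. -/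
theorem qPoch_div_succ (hQ0 : 0 < Q) (hQ1 : Q < 1) (r l : ℕ) :
    qPoch (Q ^ (r + 1))⁻¹ Q (l + 1) / qPoch Q Q (l + 1) =
      qPoch (Q ^ r)⁻¹ Q (l + 1) / qPoch Q Q (l + 1) -
        (Q ^ (r + 1))⁻¹ * (qPoch (Q ^ r)⁻¹ Q l / qPoch Q Q l) := by
  have hQ := hQ0.ne'
  have hp := (qPoch_pos hQ0.le hQ1 hQ1 (l + 1)).ne'
  have hp1 := (qPoch_pos hQ0.le hQ1 hQ1 l).ne'
  rw [qPoch_succ] at hp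
  have hp2 := right_ne_zero_of_mul hp
  rw [qPoch_succ', show (Q ^ (r + 1))⁻¹ * Q = (Q ^ r)⁻¹ by field_simp; ring, qPoch_succ, qPoch_succ]
  have hY : Q ^ r ≠ 0 := pow_ne_zero _ hQ
  simp only [pow_succ]
  generalize Q ^ l = X at *
  have hp3 : 1 - Q * X ≠ 0 := by rwa [mul_comm]
  field_simp
  ring

/-- The `₃φ₂`-form of the `q`-Meixner polynomials. -/
theorem meixner_eq_sum (hQ0 : 0 < Q) (hQ1 : Q < 1) (r : ℕ) (b : ℝ) {c : ℝ} (hc : c ≠ 0) (n L : ℕ)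
    (hL : r < L) :
    meixner Q r b c n = ∑ l ∈ Finset.range L, qPoch (Q ^ r)⁻¹ Q l / qPoch Q Q l *
      (-(Q ^ (r + 1) / c)) ^ l * (qPoch (Q ^ n)⁻¹ Q l * qPoch (b * Q ^ (r + 1)) Q (n - l) *
        ∏ k ∈ Finset.range l, (1 + b * c * Q ^ n / Q ^ k)) := by
  have hQ := hQ0.ne'
  induction r generalizing b c n L with
  | zero =>
    rw [Finset.sum_eq_single_of_mem 0 (Finset.mem_range.2 hL)]
    · simp [meixner, qPoch_zero]
    · intro l _ hl
      obtain ⟨l, rfl⟩ := Nat.exists_eq_succ_of_ne_zero hl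
      simp [qPoch_succ']
  | succ r ih =>
    obtain ⟨L, rfl⟩ : ∃ K, L = K + 1 := ⟨L - 1, by omega⟩
    have hc' : c / Q ≠ 0 := div_ne_zero hc hQ
    rw [meixner, ih (b * Q) hc' n (L + 1) (by omega), ih (b * Q) hc' (n - 1) L (by omega),
      Finset.sum_range_succ', Finset.sum_range_succ', add_sub_right_comm, Finset.mul_sum,
      ← Finset.sum_sub_distrib]
    -- The argument of the series, the base b Q^{r+1} and the product bc all agree with those of the
    -- next degree, so only the coefficients have to be compared.
    have hz : -(Q ^ (r + 1) / (c / Q)) = -(Q ^ (r + 1 + 1) / c) := by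
      field_simp
      ring
    have hbb : b * Q * Q ^ (r + 1) = b * Q ^ (r + 1 + 1) := by ring
    have hbc : b * Q * (c / Q) = b * c := by field_simp
    rw [hz, hbb, hbc]
    congr 1
    · refine Finset.sum_congr rfl fun l _ => ?_
      have hG : ((Q ^ n)⁻¹ - 1) * (1 + b * c * Q ^ n) * (qPoch (Q ^ (n - 1))⁻¹ Q l *
          qPoch (b * Q ^ (r + 1 + 1)) Q (n - 1 - l) *
          ∏ k ∈ Finset.range l, (1 + b * c * Q ^ (n - 1) / Q ^ k)) =
          -(qPoch (Q ^ n)⁻¹ Q (l + 1) * qPoch (b * Q ^ (r + 1 + 1)) Q (n - (l + 1)) *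
          ∏ k ∈ Finset.range (l + 1), (1 + b * c * Q ^ n / Q ^ k)) := by
        rcases n with _ | n
        · simp [qPoch_succ']
        · rw [Finset.prod_range_succ', qPoch_succ' (Q ^ (n + 1))⁻¹, Nat.add_sub_cancel,
            show (Q ^ (n + 1))⁻¹ * Q = (Q ^ n)⁻¹ by field_simp; ring,
            show n + 1 - (l + 1) = n - l by omega]
          have : ∀ k, b * c * Q ^ (n + 1) / Q ^ (k + 1) = b * c * Q ^ n / Q ^ k := fun k => by
            field_simp
            ring
          simp only [this, pow_zero, div_one]
          ring
      have hzz : Q / c = -(-(Q ^ (r + 1 + 1) / c)) * (Q ^ (r + 1))⁻¹ := by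
        field_simp
        ring
      rw [qPoch_div_succ hQ0 hQ1 r l]
      generalize -(Q ^ (r + 1 + 1) / c) = z at *
      rw [pow_succ z, hzz]
      linear_combination -(-z * (Q ^ (r + 1))⁻¹ * (qPoch (Q ^ r)⁻¹ Q l / qPoch Q Q l) * z ^ l) * hG

end Meixner

/-! ### Matrix entries and self-adjointness of the operator. -/

section Operator

open Filter Topology

open scoped InnerProductSpace

theorem L2_inner_single {I : Type} [DecidableEq I] (i : I) (x : L2 I) :
    ⟪(lp.single 2 i (1 : ℂ) : L2 I), x⟫_ℂ = x i := by
  rw [lp.inner_single_left]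
  simp

theorem L2_add_apply {I : Type} (x y : L2 I) (i : I) : (x + y) i = x i + y i := rfl

theorem L2_smul_apply {I : Type} (c : ℂ) (x : L2 I) (i : I) : (c • x) i = c * x i := rfl

theorem L2_single_apply {I : Type} [DecidableEq I] (i j : I) :
    (lp.single 2 j (1 : ℂ) : L2 I) i = if i = j then 1 else 0 := by
  rw [lp.single_apply, Pi.single_apply]

theorem L2_star_apply {I : Type} [DecidableEq I] (T : L2 I →L[ℂ] L2 I) (x : L2 I) (i : I) :
    (star T x) i = ⟪T (lp.single 2 i (1 : ℂ)), x⟫_ℂ := by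
  rw [← L2_inner_single i, ContinuousLinearMap.star_eq_adjoint,
    ContinuousLinearMap.adjoint_inner_right]

theorem opTensor_apply {I J : Type} (T : L2 I →L[ℂ] L2 I) (S : L2 J →L[ℂ] L2 J)
    (x : L2 (I × J)) (i : I) (j : J) :
    opTensor T S x (i, j) =
      T (slice (Equiv.refl (I × J)) j (amplify (Equiv.prodComm J I) S x)) i := rfl

theorem slice_amplify_apply {I J : Type} (S : L2 J →L[ℂ] L2 J) (x : L2 (I × J)) (i : I) (j : J) :
    slice (Equiv.refl (I × J)) j (amplify (Equiv.prodComm J I) S x) i =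
      S (slice (Equiv.prodComm J I) i x) j := rfl

theorem aPlus_apply (q : ℝ) (x : L2 (ℕ × ℤ)) (n : ℕ) (m : ℤ) :
    aPlus q x (n, m) = (√(1 - (q ^ 2) ^ (n + 1)) : ℂ) * x (n + 1, m) := rfl

theorem bPlus_apply (q : ℝ) (hq0 : 0 < q) (hq1 : q < 1) (x : L2 (ℕ × ℤ)) (n : ℕ) (m : ℤ) :
    bPlus q hq0 hq1 x (n, m) = (q ^ n : ℝ) * x (n, m - 1) := by
  have : bPlus q hq0 hq1 x (n, m) = ((q ^ n : ℝ) : ℂ) * (((1 : ℝ) : ℂ) * x (n, m - 1)) := rfl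
  rw [this]
  simp

theorem podlesY_one_apply (q : ℝ) (x : L2 ℕ) (k : ℕ) :
    podlesY q 1 x k = (√(1 - (q ^ 2) ^ (2 * (k + 1))) : ℂ) * x (k + 1) := by
  have : podlesY q 1 x k = (sgn 1 : ℂ) * ((√(1 - (q ^ 2) ^ (2 * (k + 1))) : ℂ) * x (k + 1)) := rfl
  rw [this]
  simp [sgn]

theorem podlesW_one_apply (q : ℝ) (hq0 : 0 < q) (hq1 : q < 1) (x : L2 ℕ) (k : ℕ) :
    podlesW q hq0 hq1 1 x k = (q ^ (2 * k) : ℝ) * x k := by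
  have : podlesW q hq0 hq1 1 x k = (sgn 1 : ℂ) * ((q ^ (2 * k) : ℝ) * x k) := rfl
  rw [this]
  simp [sgn]

/-- If `T e_i = w • e_j` with `w` real, then `(T* x) i = w * x j`. -/
theorem L2_star_apply_of_single {I : Type} [DecidableEq I] (T : L2 I →L[ℂ] L2 I) (i j : I) (w : ℝ)
    (h : ∀ k, T (lp.single 2 i (1 : ℂ)) k = if k = j then (w : ℂ) else 0) (x : L2 I) :
    star T x i = w * x j := by
  rw [L2_star_apply]
  have : T (lp.single 2 i (1 : ℂ)) = (w : ℂ) • (lp.single 2 j (1 : ℂ) : L2 I) := by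
    ext k
    rw [h k, lp.coeFn_smul, Pi.smul_apply, lp.single_apply]
    by_cases hk : k = j
    · subst hk; simp
    · simp [hk]
  rw [this, inner_smul_left, L2_inner_single]
  simp

theorem star_aPlus_apply_zero (q : ℝ) (x : L2 (ℕ × ℤ)) (m : ℤ) : star (aPlus q) x (0, m) = 0 := by
  have := L2_star_apply_of_single (aPlus q) (0, m) (0, m) 0 (fun k => by
    obtain ⟨n, l⟩ := k
    rw [aPlus_apply, lp.single_apply]
    simp) x
  simpa using this

theorem star_aPlus_apply_succ (q : ℝ) (x : L2 (ℕ × ℤ)) (n : ℕ) (m : ℤ) :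
    star (aPlus q) x (n + 1, m) = (√(1 - (q ^ 2) ^ (n + 1)) : ℂ) * x (n, m) := by
  refine L2_star_apply_of_single (aPlus q) (n + 1, m) (n, m) _ (fun k => ?_) x
  obtain ⟨n', l⟩ := k
  rw [aPlus_apply, lp.single_apply]
  by_cases h1 : n' = n
  · subst h1
    by_cases h2 : l = m
    · subst h2; simp
    · simp [h2]
  · simp [h1]

theorem star_bPlus_apply (q : ℝ) (hq0 : 0 < q) (hq1 : q < 1) (x : L2 (ℕ × ℤ)) (n : ℕ) (m : ℤ) :
    star (bPlus q hq0 hq1) x (n, m) = (q ^ n : ℝ) * x (n, m + 1) := by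
  refine L2_star_apply_of_single (bPlus q hq0 hq1) (n, m) (n, m + 1) _ (fun k => ?_) x
  obtain ⟨n', l⟩ := k
  rw [bPlus_apply, lp.single_apply]
  by_cases h1 : n' = n
  · subst h1
    by_cases h2 : l = m + 1
    · subst h2; simp
    · have : l - 1 ≠ m := fun h => h2 (by omega)
      simp [h2, this]
  · simp [h1]

theorem star_podlesY_one_apply_zero (q : ℝ) (x : L2 ℕ) : star (podlesY q 1) x 0 = 0 := by
  have := L2_star_apply_of_single (podlesY q 1) 0 0 0 (fun k => by
    rw [podlesY_one_apply, lp.single_apply]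
    simp) x
  simpa using this

theorem star_podlesY_one_apply_succ (q : ℝ) (x : L2 ℕ) (k : ℕ) :
    star (podlesY q 1) x (k + 1) = (√(1 - (q ^ 2) ^ (2 * (k + 1))) : ℂ) * x k := by
  refine L2_star_apply_of_single (podlesY q 1) (k + 1) k _ (fun l => ?_) x
  rw [podlesY_one_apply, lp.single_apply]
  by_cases h1 : l = k
  · subst h1; simp
  · simp [h1]

/-- The off-diagonal entry of `α̃₊(W)` between `e_n ⊗ e_m ⊗ e_k` and
`e_{n+1} ⊗ e_{m-1} ⊗ e_{k+1}`. -/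
noncomputable def offDiag (q : ℝ) (n k : ℕ) : ℝ :=
  q ^ n * √(1 - (q ^ 2) ^ (n + 1)) * √(1 - (q ^ 2) ^ (2 * (k + 1)))

/-- The diagonal entry of `α̃₊(W)` at `e_n ⊗ e_m ⊗ e_k`. -/
noncomputable def onDiag (q : ℝ) (n k : ℕ) : ℝ :=
  (1 - (1 + q ^ 2) * (q ^ n * q ^ n)) * q ^ (2 * k)

theorem alphaTildeW_apply (q : ℝ) (hq0 : 0 < q) (hq1 : q < 1) (x : L2 ((ℕ × ℤ) × ℕ))
    (n : ℕ) (m : ℤ) (k : ℕ) :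
    alphaTildeW q hq0 hq1 1 x ((n, m), k) =
      (if n = 0 ∨ k = 0 then 0 else
        (offDiag q (n - 1) (k - 1) : ℂ) * x ((n - 1, m + 1), k - 1)) +
      onDiag q n k * x ((n, m), k) + offDiag q n k * x ((n + 1, m - 1), k + 1) := by
  have h0 : alphaTildeW q hq0 hq1 1 x ((n, m), k) =
    opTensor (star (aPlus q) * star (bPlus q hq0 hq1)) (star (podlesY q 1)) x ((n, m), k)
    + opTensor (1 - ((1 + q ^ 2 : ℝ) : ℂ) • (star (bPlus q hq0 hq1) * bPlus q hq0 hq1))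
        (podlesW q hq0 hq1 1) x ((n, m), k)
    + opTensor (bPlus q hq0 hq1 * aPlus q) (podlesY q 1) x ((n, m), k) := rfl
  rw [h0]
  congr 1
  · congr 1
    · rw [opTensor_apply, mul_apply_eq_comp]
      rcases n with _ | n
      · rw [star_aPlus_apply_zero]; simp
      · rw [star_aPlus_apply_succ, star_bPlus_apply, slice_amplify_apply]
        rcases k with _ | k
        · rw [star_podlesY_one_apply_zero]; simp
        · rw [star_podlesY_one_apply_succ]
          have : slice (Equiv.prodComm ℕ (ℕ × ℤ)) (n, m + 1) x k = x ((n, m + 1), k) := rfl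
          rw [this]
          simp [offDiag]
          ring
    · rw [opTensor_apply]
      set y := slice (Equiv.refl ((ℕ × ℤ) × ℕ)) k
        (amplify (Equiv.prodComm ℕ (ℕ × ℤ)) (podlesW q hq0 hq1 1) x) with hy
      have h1 : (1 - ((1 + q ^ 2 : ℝ) : ℂ) • (star (bPlus q hq0 hq1) * bPlus q hq0 hq1)) y (n, m) =
        y (n, m) - ((1 + q ^ 2 : ℝ) : ℂ) * star (bPlus q hq0 hq1) (bPlus q hq0 hq1 y) (n, m) := rfl
      rw [h1, star_bPlus_apply, bPlus_apply, add_sub_cancel_right, hy, slice_amplify_apply,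
        podlesW_one_apply]
      have : slice (Equiv.prodComm ℕ (ℕ × ℤ)) (n, m) x k = x ((n, m), k) := rfl
      rw [this]
      simp [onDiag]
      ring
  · rw [opTensor_apply, mul_apply_eq_comp, bPlus_apply, aPlus_apply,
      slice_amplify_apply, podlesY_one_apply]
    have : slice (Equiv.prodComm ℕ (ℕ × ℤ)) (n + 1, m - 1) x (k + 1) =
      x ((n + 1, m - 1), k + 1) := rfl
    rw [this]
    simp [offDiag]
    ring

theorem alphaTildeW_single (q : ℝ) (hq0 : 0 < q) (hq1 : q < 1) (n : ℕ) (m : ℤ) (k : ℕ) :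
    alphaTildeW q hq0 hq1 1 (lp.single 2 ((n, m), k) (1 : ℂ)) =
      (if n = 0 ∨ k = 0 then 0 else
        (offDiag q (n - 1) (k - 1) : ℂ) • lp.single 2 ((n - 1, m + 1), k - 1) (1 : ℂ)) +
      (onDiag q n k : ℂ) • lp.single 2 ((n, m), k) (1 : ℂ) +
      (offDiag q n k : ℂ) • lp.single 2 ((n + 1, m - 1), k + 1) (1 : ℂ) := by
  ext ⟨⟨n', m'⟩, k'⟩
  rw [alphaTildeW_apply, add_comm (_ + _), ← add_assoc, add_right_comm]
  simp only [lp.coeFn_add, Pi.add_apply, lp.coeFn_smul, Pi.smul_apply, lp.single_apply,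
    Pi.single_apply, smul_eq_mul, Prod.mk.injEq]
  have hfirst : (if n' = 0 ∨ k' = 0 then 0 else (offDiag q (n' - 1) (k' - 1) : ℂ) *
      if (n' - 1 = n ∧ m' + 1 = m) ∧ k' - 1 = k then (1 : ℂ) else 0) =
      offDiag q n k * if (n' = n + 1 ∧ m' = m - 1) ∧ k' = k + 1 then 1 else 0 := by
    by_cases h : (n' = n + 1 ∧ m' = m - 1) ∧ k' = k + 1
    · obtain ⟨⟨rfl, rfl⟩, rfl⟩ := h
      simp
    · rw [if_neg h, mul_zero]
      split_ifs with h1 h2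
      · rfl
      · exact absurd ⟨⟨by omega, by omega⟩, by omega⟩ h
      · simp
  have hlast : (offDiag q n' k' : ℂ) *
      (if (n' + 1 = n ∧ m' - 1 = m) ∧ k' + 1 = k then (1 : ℂ) else 0) =
      (if n = 0 ∨ k = 0 then 0 else
        (offDiag q (n - 1) (k - 1) : ℂ) • lp.single 2 ((n - 1, m + 1), k - 1) (1 : ℂ) :
          L2 ((ℕ × ℤ) × ℕ)) ((n', m'), k') := by
    by_cases h : (n' + 1 = n ∧ m' - 1 = m) ∧ k' + 1 = k
    · obtain ⟨⟨rfl, rfl⟩, rfl⟩ := h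
      have : ¬(n' + 1 = 0 ∨ k' + 1 = 0) := by omega
      rw [if_neg this, L2_smul_apply, L2_single_apply, if_pos ⟨⟨rfl, rfl⟩, rfl⟩, if_pos (by simp)]
      rfl
    · rw [if_neg h, mul_zero]
      split_ifs with h1
      · rfl
      · have : ¬((n', m'), k') = ((n - 1, m + 1), k - 1) := fun h2 => by
          simp only [Prod.mk.injEq] at h2
          exact h ⟨⟨by omega, by omega⟩, by omega⟩
        rw [lp.coeFn_smul, Pi.smul_apply, lp.single_apply, Pi.single_apply, if_neg this]
        simp
  rw [hfirst, hlast]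
  by_cases h : (n' = n ∧ m' = m) ∧ k' = k
  · obtain ⟨⟨rfl, rfl⟩, rfl⟩ := h
    ring
  · simp only [h, if_false, mul_zero]

theorem alphaTildeW_isSelfAdjoint (q : ℝ) (hq0 : 0 < q) (hq1 : q < 1) :
    IsSelfAdjoint (alphaTildeW q hq0 hq1 1) := by
  refine ContinuousLinearMap.ext fun x => ?_
  ext ⟨⟨n, m⟩, k⟩
  rw [L2_star_apply, alphaTildeW_single, alphaTildeW_apply, inner_add_left, inner_add_left,
    inner_smul_left, inner_smul_left, L2_inner_single, L2_inner_single]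
  congr 2
  · split_ifs
    · simp
    · rw [inner_smul_left, L2_inner_single]
      simp
  · simp
  · simp

theorem alphaTildeW_inner (q : ℝ) (hq0 : 0 < q) (hq1 : q < 1) (x y : L2 ((ℕ × ℤ) × ℕ)) :
    ⟪alphaTildeW q hq0 hq1 1 x, y⟫_ℂ = ⟪x, alphaTildeW q hq0 hq1 1 y⟫_ℂ := by
  have h := alphaTildeW_isSelfAdjoint q hq0 hq1
  rw [← ContinuousLinearMap.adjoint_inner_right, ← ContinuousLinearMap.star_eq_adjoint, h.star_eq]

/-- By self-adjointness the squared norm of a column is a diagonal entry of the square of the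
operator. -/
theorem norm_alphaTildeW_single_sq (q : ℝ) (hq0 : 0 < q) (hq1 : q < 1) (n : ℕ) (m : ℤ) (k : ℕ) :
    ‖alphaTildeW q hq0 hq1 1 (lp.single 2 ((n, m), k) (1 : ℂ))‖ ^ 2 =
      (if n = 0 ∨ k = 0 then 0 else offDiag q (n - 1) (k - 1) ^ 2) + onDiag q n k ^ 2 +
        offDiag q n k ^ 2 := by
  have h : (‖alphaTildeW q hq0 hq1 1 (lp.single 2 ((n, m), k) (1 : ℂ))‖ ^ 2 : ℂ) =
      (((if n = 0 ∨ k = 0 then 0 else offDiag q (n - 1) (k - 1) ^ 2) + onDiag q n k ^ 2 +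
        offDiag q n k ^ 2 : ℝ) : ℂ) := by
    have h1 := inner_self_eq_norm_sq_to_K (𝕜 := ℂ)
      (alphaTildeW q hq0 hq1 1 (lp.single 2 ((n, m), k) (1 : ℂ)))
    refine h1.symm.trans ?_
    rw [alphaTildeW_inner, L2_inner_single]
    rw [alphaTildeW_apply]
    have e : ∀ i : (ℕ × ℤ) × ℕ, alphaTildeW q hq0 hq1 1 (lp.single 2 ((n, m), k) (1 : ℂ)) i =
      ((if n = 0 ∨ k = 0 then 0 else
        (offDiag q (n - 1) (k - 1) : ℂ) • lp.single 2 ((n - 1, m + 1), k - 1) (1 : ℂ)) +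
      (onDiag q n k : ℂ) • lp.single 2 ((n, m), k) (1 : ℂ) +
      (offDiag q n k : ℂ) • lp.single 2 ((n + 1, m - 1), k + 1) (1 : ℂ) :
          L2 ((ℕ × ℤ) × ℕ)) i := fun i => by rw [alphaTildeW_single]
    rw [e, e, e]
    rcases n with _ | n
    · simp only [true_or, if_true, L2_add_apply, L2_smul_apply, L2_single_apply, zero_add]
      simp
      ring
    · rcases k with _ | k
      · simp only [or_true, if_true, L2_add_apply, L2_smul_apply, L2_single_apply, zero_add]
        simp
        ring
      · have hne : ¬(n + 1 = 0 ∨ k + 1 = 0) := by omega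
        have hn : n ≠ n + 1 + 1 := by omega
        simp only [hne, if_false, L2_add_apply, L2_smul_apply, L2_single_apply]
        simp [hn, hn.symm]
        ring
  exact_mod_cast h

end Operator

/-! ### The coefficients Q as weighted q-Meixner polynomials: norm and recurrence. -/

section Coefficients

open Filter Topology

variable {Q : ℝ}

theorem qPoch_inv_pow_eq_zero (hQ0 : 0 < Q) {n l : ℕ} (h : n < l) : qPoch (Q ^ n)⁻¹ Q l = 0 := by
  refine Finset.prod_eq_zero (Finset.mem_range.2 h) ?_
  rw [mul_inv_cancel₀ (pow_ne_zero _ hQ0.ne'), sub_self]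

theorem qPoch_add (a Q : ℝ) (m l : ℕ) :
    qPoch a Q (m + l) = qPoch a Q m * ∏ k ∈ Finset.range l, (1 - Q ^ (m + l - 1 - k) * a) := by
  rw [qPoch, Finset.prod_range_add, ← Finset.prod_range_reflect (fun k => 1 - Q ^ (m + k) * a)]
  congr 1
  refine Finset.prod_congr rfl fun k hk => ?_
  rw [Finset.mem_range] at hk
  rw [show m + (l - 1 - k) = m + l - 1 - k by omega]

/-- The last l factors of (bQ^{r+1};Q)_n absorb the lower parameter of the ₃φ₂, which leaves the
denominator-free sum of `meixner_eq_sum`. The hypothesis `hne` keeps that lower parameter from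
producing zeros for l ≤ n. -/
theorem qPoch_mul_phi32 (hQ0 : 0 < Q) (hQ1 : Q < 1) {r n : ℕ} {b : ℝ} (hb : b ≠ 0)
    (hne : ∀ j : ℕ, b * Q ^ (r + j + 1) ≠ 1) :
    qPoch (b * Q ^ (r + 1)) Q n * phi32 (Q ^ n)⁻¹ (Q ^ r)⁻¹ (-(b * Q ^ n)⁻¹) (b * Q ^ (n + r))⁻¹ 0
      Q Q = meixner Q r b 1 n := by
  have hQ := hQ0.ne'
  rw [meixner_eq_sum hQ0 hQ1 r b one_ne_zero n (r + 1) (Nat.lt_succ_self r), phi32,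
    tsum_eq_sum (s := Finset.range (r + 1)), Finset.mul_sum]
  · refine Finset.sum_congr rfl fun l hl => ?_
    -- For l > n both sides vanish through (Q^{-n};Q)_l, so neither the truncated `n - l` nor a zero
    -- denominator matters.
    rcases lt_or_ge n l with hln | hln
    · simp [qPoch_inv_pow_eq_zero hQ0 hln]
    · obtain ⟨m, rfl⟩ : ∃ m, n = m + l := ⟨n - l, by omega⟩
      rw [Finset.mem_range] at hl
      have hD : ∀ k ∈ Finset.range l, 1 - Q ^ k * (b * Q ^ (m + l + r))⁻¹ ≠ 0 := fun k hk h => by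
        rw [Finset.mem_range] at hk
        refine hne (m + l - 1 - k) ?_
        have e : Q ^ (m + l + r) = Q ^ (r + (m + l - 1 - k) + 1) * Q ^ k := by
          rw [← pow_add]; congr 1; omega
        have hX := pow_ne_zero k hQ
        rw [e] at h
        have h2 : Q ^ k * (b * (Q ^ (r + (m + l - 1 - k) + 1) * Q ^ k))⁻¹ =
          (b * Q ^ (r + (m + l - 1 - k) + 1))⁻¹ := by field_simp
        rw [h2, sub_eq_zero, eq_comm, inv_eq_one] at h
        exact h
      have hprod : (∏ k ∈ Finset.range l, (1 - Q ^ (m + l - 1 - k) * (b * Q ^ (r + 1)))) *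
          qPoch (-(b * Q ^ (m + l))⁻¹) Q l / qPoch (b * Q ^ (m + l + r))⁻¹ Q l =
          ∏ k ∈ Finset.range l, (-(Q ^ r * (1 + b * 1 * Q ^ (m + l) / Q ^ k))) := by
        rw [qPoch, qPoch, ← Finset.prod_mul_distrib, ← Finset.prod_div_distrib]
        refine Finset.prod_congr rfl fun k hk => ?_
        rw [div_eq_iff (hD k hk)]
        rw [Finset.mem_range] at hk
        obtain ⟨d, hd⟩ : ∃ d, m + l = d + 1 + k := ⟨m + l - 1 - k, by omega⟩
        rw [hd, show d + 1 + k - 1 - k = d by omega]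
        simp only [pow_add, pow_one]
        have := pow_ne_zero k hQ
        have := pow_ne_zero d hQ
        have := pow_ne_zero r hQ
        field_simp
        ring
      have hzero : qPoch 0 Q l = 1 := by simp [qPoch]
      have hsplit : ∏ k ∈ Finset.range l, (-(Q ^ r * (1 + b * 1 * Q ^ (m + l) / Q ^ k))) =
          (-(Q ^ r)) ^ l * ∏ k ∈ Finset.range l, (1 + b * 1 * Q ^ (m + l) / Q ^ k) := by
        rw [← Finset.card_range l, ← Finset.prod_const, Finset.card_range,
          ← Finset.prod_mul_distrib]
        exact Finset.prod_congr rfl fun k _ => by ring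
      rw [hsplit] at hprod
      rw [qPoch_add, hzero, Nat.add_sub_cancel, div_one,
        show -Q ^ (r + 1) = -(Q ^ r) * Q by ring, mul_pow (-(Q ^ r))]
      linear_combination (qPoch (b * Q ^ (r + 1)) Q m * qPoch (Q ^ (m + l))⁻¹ Q l *
        qPoch (Q ^ r)⁻¹ Q l / qPoch Q Q l * Q ^ l) * hprod
  · intro l hl
    rw [Finset.mem_range, not_lt] at hl
    simp [qPoch_inv_pow_eq_zero hQ0 (Nat.lt_of_succ_le hl)]

/-- Merges the two infinite products of `meixnerWeight` into the single base-q⁴ product in `coeffQ`.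
-/
theorem qPochInf_neg_mul_self (hQ0 : 0 ≤ Q) (hQ1 : Q < 1) (z : ℝ) :
    qPochInf (-z) Q * qPochInf z Q = qPochInf (z ^ 2) (Q ^ 2) := by
  refine tendsto_nhds_unique ((tendsto_qPoch hQ0 hQ1 (-z)).mul (tendsto_qPoch hQ0 hQ1 z)) ?_
  refine (tendsto_qPoch (by positivity) (pow_lt_one₀ hQ0 hQ1 two_ne_zero) (z ^ 2)).congr
    fun n => ?_
  rw [qPoch, qPoch, qPoch, ← Finset.prod_mul_distrib]
  exact Finset.prod_congr rfl fun k _ => by ring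

theorem qPoch_self_mul_neg (Q : ℝ) (r : ℕ) :
    qPoch (Q ^ 2) (Q ^ 2) r = qPoch Q Q r * qPoch (-Q) Q r := by
  rw [qPoch, qPoch, qPoch, ← Finset.prod_mul_distrib]
  exact Finset.prod_congr rfl fun k _ => by ring

theorem mem_indexJ_one (j : ℤ) : j ∈ indexJ 1 := by simp [indexJ, indexI]

theorem mem_indexJ_neg_one {j : ℤ} : j ∈ indexJ (-1) ↔ 0 ≤ j := by
  have h : ¬((-1 : ℤˣ) = 1) := by decide
  simp only [indexJ, indexI, if_neg h, Set.mem_ofPred_eq]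
  omega

theorem sgn_one : sgn 1 = 1 := by simp [sgn]

theorem sgn_neg_one : sgn (-1) = -1 := by simp [sgn]

theorem sgn_mul_self (ε : ℤˣ) : sgn ε * sgn ε = 1 := by
  rcases Int.units_eq_one_or ε with rfl | rfl <;> simp [sgn]

variable {q : ℝ}

/-- The role of the index sets J: this makes the product under the root in the denominator of
`coeffQ` positive and keeps the ₃φ₂ free of zero denominators. -/
theorem neg_sgn_mul_zpow_lt_one (hq0 : 0 < q) (hq1 : q < 1) {ε : ℤˣ} {p : ℤ} {r : ℕ}
    (h : p + r ∈ indexJ ε) (j : ℕ) : -sgn ε * q ^ (2 * p + 2 * r + 2 + 2 * j) < 1 := by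
  rcases Int.units_eq_one_or ε with rfl | rfl
  · rw [sgn_one]
    have : 0 < q ^ (2 * p + 2 * r + 2 + 2 * j) := zpow_pos hq0 _
    linarith
  · rw [mem_indexJ_neg_one] at h
    rw [sgn_neg_one, neg_neg, one_mul]
    exact zpow_lt_one₀ hq0 hq1 (by omega)

/-- The factor of `coeffQ` that does not depend on `n`. -/
noncomputable def coeffConst (q : ℝ) (ε : ℤˣ) (p : ℤ) (r : ℕ) : ℝ :=
  (-sgn ε * q) ^ r / (√(qPochInf (-sgn ε * q ^ (2 * p + 2 * r + 2)) (q ^ 2))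
    * √(qPoch (q ^ 4) (q ^ 4) r) * √(qPochInf (-1) (q ^ 2)))

/-- The factor of `coeffQ` that does not depend on `r`. -/
noncomputable def coeffWeight (q : ℝ) (ε : ℤˣ) (p : ℤ) (n : ℕ) : ℝ :=
  sgn ε ^ n * q ^ (n * (n - 1) / 2) * √(qPochInf (q ^ (4 * p + 4 * n + 4)) (q ^ 4))
    / √(qPoch (q ^ 2) (q ^ 2) n)

/-- The polynomial factor of `coeffQ`. -/
noncomputable def coeffPoly (q : ℝ) (ε : ℤˣ) (p : ℤ) (r n : ℕ) : ℝ :=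
  meixner (q ^ 2) r (-sgn ε * q ^ (2 * p)) 1 n

theorem coeffQ_eq (hq0 : 0 < q) (hq1 : q < 1) {ε : ℤˣ} {p : ℤ} {r : ℕ} (h : p + r ∈ indexJ ε)
    (n : ℕ) :
    coeffQ q ε p r n = coeffConst q ε p r * coeffWeight q ε p n * coeffPoly q ε p r n := by
  have hQ0 : 0 < q ^ 2 := by positivity
  have hQ1 : q ^ 2 < 1 := pow_lt_one₀ hq0.le hq1 two_ne_zero
  have hs : sgn ε ≠ 0 := left_ne_zero_of_mul (sgn_mul_self ε ▸ one_ne_zero)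
  have hsi : (sgn ε)⁻¹ = sgn ε := inv_eq_of_mul_eq_one_left (sgn_mul_self ε)
  have hz : q ^ (2 * p) ≠ 0 := zpow_ne_zero _ hq0.ne'
  have hpow : ∀ j : ℕ, (q ^ 2) ^ j = q ^ (2 * (j : ℤ)) := fun j => by
    rw [← pow_mul]; exact_mod_cast (zpow_natCast q (2 * j)).symm
  have key := qPoch_mul_phi32 (Q := q ^ 2) hQ0 hQ1 (r := r) (n := n)
    (b := -sgn ε * q ^ (2 * p)) (mul_ne_zero (neg_ne_zero.2 hs) hz) (fun j => by
      have := (neg_sgn_mul_zpow_lt_one hq0 hq1 h j).ne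
      rw [hpow, mul_assoc, ← zpow_add₀ hq0.ne']
      convert this using 3
      push_cast
      ring)
  have e1 : -sgn ε * q ^ (2 * p) * (q ^ 2) ^ (r + 1) = -sgn ε * q ^ (2 * p + 2 * r + 2) := by
    rw [hpow, mul_assoc, ← zpow_add₀ hq0.ne']
    congr 2
    push_cast
    ring
  have e2 : ∀ j : ℕ, ((q ^ 2) ^ j)⁻¹ = q ^ (-2 * (j : ℤ)) := fun j => by
    rw [hpow, ← zpow_neg, neg_mul]
  have e3 : -(-sgn ε * q ^ (2 * p) * (q ^ 2) ^ n)⁻¹ = sgn ε * q ^ (-2 * p - 2 * n) := by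
    rw [mul_inv, e2, mul_inv, inv_neg, hsi, ← zpow_neg, mul_assoc, ← zpow_add₀ hq0.ne', neg_mul,
      neg_neg]
    congr 2
    ring
  have e4 : (-sgn ε * q ^ (2 * p) * (q ^ 2) ^ (n + r))⁻¹ =
      -sgn ε * q ^ (-2 * p - 2 * n - 2 * r) := by
    rw [mul_inv, e2, mul_inv, inv_neg, hsi, ← zpow_neg, mul_assoc, ← zpow_add₀ hq0.ne']
    congr 2
    push_cast
    ring
  rw [e1, e2, e2, e3, e4] at key
  rw [coeffPoly, ← key, coeffQ, coeffConst, coeffWeight]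
  generalize phi32 _ _ _ _ _ _ _ = φ
  simp only [div_eq_mul_inv, mul_inv]
  ring

theorem sq_sqrt_qPochInf (hq0 : 0 < q) (hq1 : q < 1) (p : ℤ) (n : ℕ) :
    √(qPochInf (q ^ (4 * p + 4 * n + 4)) (q ^ 4)) ^ 2 = qPochInf (q ^ (4 * p + 4 * n + 4)) (q ^ 4) := by
  have hQ1 : q ^ 4 < 1 := pow_lt_one₀ hq0.le hq1 (by norm_num)
  refine Real.sq_sqrt ?_
  rcases le_or_gt 0 (p + n) with h | h
  · exact (qPochInf_pos (by positivity) hQ1 (zpow_lt_one₀ hq0 hq1 (by omega))).le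
  · refine (qPochInf_eq_zero (by positivity) hQ1 (k := (-(p + n + 1)).toNat) ?_).ge
    rw [← pow_mul, ← zpow_natCast, ← zpow_add₀ hq0.ne']
    have : 4 * p + 4 * (n : ℤ) + 4 + ((4 * (-(p + n + 1)).toNat : ℕ) : ℤ) = 0 := by omega
    rw [this, zpow_zero]

/-- The infinite product under the root contains the factor 1 - q⁰, so the coefficients vanish
before the start of the chain. -/
theorem coeffQ_eq_zero (hq0 : 0 < q) (hq1 : q < 1) (ε : ℤˣ) {p : ℤ} (r : ℕ) {n : ℕ}
    (hpn : p + n < 0) : coeffQ q ε p r n = 0 := by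
  have hQ1 : q ^ 4 < 1 := pow_lt_one₀ hq0.le hq1 (by norm_num)
  have : qPochInf (q ^ (4 * p + 4 * n + 4)) (q ^ 4) = 0 := by
    refine qPochInf_eq_zero (by positivity) hQ1 (k := (-(p + n + 1)).toNat) ?_
    rw [← pow_mul, ← zpow_natCast, ← zpow_add₀ hq0.ne']
    have : 4 * p + 4 * (n : ℤ) + 4 + ((4 * (-(p + n + 1)).toNat : ℕ) : ℤ) = 0 := by omega
    rw [this, zpow_zero]
  simp [coeffQ, this]

theorem hasSum_coeffQ_sq (hq0 : 0 < q) (hq1 : q < 1) {ε : ℤˣ} {p : ℤ} {r : ℕ}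
    (h : p + r ∈ indexJ ε) : HasSum (fun n => coeffQ q ε p r n ^ 2) 1 := by
  have hQ0 : 0 < q ^ 2 := by positivity
  have hQ1 : q ^ 2 < 1 := pow_lt_one₀ hq0.le hq1 two_ne_zero
  have hpow : ∀ j : ℕ, (q ^ 2) ^ j = q ^ (2 * (j : ℤ)) := fun j => by
    rw [← pow_mul]; exact_mod_cast (zpow_natCast q (2 * j)).symm
  have hsum := (hasSum_meixner_sq hQ0 hQ1 r (-sgn ε * q ^ (2 * p)) one_ne_zero).mul_left
    (coeffConst q ε p r ^ 2)
  have e1 : -sgn ε * q ^ (2 * p) * (q ^ 2) ^ (r + 1) = -sgn ε * q ^ (2 * p + 2 * r + 2) := by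
    rw [hpow, mul_assoc, ← zpow_add₀ hq0.ne']
    congr 2
    push_cast
    ring
  have hA : 0 < qPochInf (-sgn ε * q ^ (2 * p + 2 * r + 2)) (q ^ 2) :=
    qPochInf_pos hQ0.le hQ1 (by simpa using neg_sgn_mul_zpow_lt_one hq0 hq1 h 0)
  have hB : 0 < qPoch (q ^ 2) (q ^ 2) r := qPoch_pos hQ0.le hQ1 hQ1 r
  have hB' : 0 < qPoch (-q ^ 2) (q ^ 2) r := qPoch_pos hQ0.le hQ1 (by linarith) r
  have hC : 0 < qPochInf (-1) (q ^ 2) := qPochInf_pos hQ0.le hQ1 (by norm_num)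
  have hconst : coeffConst q ε p r ^ 2 = (q ^ 2) ^ r /
      (qPochInf (-sgn ε * q ^ (2 * p + 2 * r + 2)) (q ^ 2) *
        (qPoch (q ^ 2) (q ^ 2) r * qPoch (-q ^ 2) (q ^ 2) r) * qPochInf (-1) (q ^ 2)) := by
    have hs : (-sgn ε * q) ^ 2 = q ^ 2 := by linear_combination q ^ 2 * sgn_mul_self ε
    rw [coeffConst, div_pow, ← pow_mul, mul_comm r 2, pow_mul, hs, mul_pow, mul_pow,
      Real.sq_sqrt hA.le, Real.sq_sqrt hC.le, show q ^ 4 = (q ^ 2) ^ 2 by ring,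
      qPoch_self_mul_neg, Real.sq_sqrt (mul_pos hB hB').le]
  rw [hconst, e1, div_one] at hsum
  have hval : (q ^ 2) ^ r / (qPochInf (-sgn ε * q ^ (2 * p + 2 * r + 2)) (q ^ 2) *
        (qPoch (q ^ 2) (q ^ 2) r * qPoch (-q ^ 2) (q ^ 2) r) * qPochInf (-1) (q ^ 2)) *
      (qPoch (q ^ 2) (q ^ 2) r * qPoch (-q ^ 2) (q ^ 2) r / (q ^ 2) ^ r *
        qPochInf (-sgn ε * q ^ (2 * p + 2 * r + 2)) (q ^ 2) * qPochInf (-1) (q ^ 2)) = 1 := by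
    generalize qPochInf (-sgn ε * q ^ (2 * p + 2 * r + 2)) (q ^ 2) = A at *
    field_simp
  rw [hval] at hsum
  refine hsum.congr_fun ?_
  intro n
  have hs : (sgn ε ^ n) ^ 2 = 1 := by
    rw [← pow_mul, mul_comm, pow_mul, sq, sgn_mul_self, one_pow]
  rw [coeffQ_eq hq0 hq1 h, mul_pow, mul_pow, hconst, coeffPoly, coeffWeight, meixnerWeight, div_pow,
    mul_pow, mul_pow, hs, sq_sqrt_qPochInf hq0 hq1, Real.sq_sqrt (qPoch_pos hQ0.le hQ1 hQ1 n).le,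
    mul_one (-sgn ε * q ^ (2 * p))]
  have hinf := qPochInf_neg_mul_self hQ0.le hQ1 (-sgn ε * q ^ (2 * p) * (q ^ 2) ^ (n + 1))
  have e2 : (-sgn ε * q ^ (2 * p) * (q ^ 2) ^ (n + 1)) ^ 2 = q ^ (4 * p + 4 * n + 4) := by
    rw [hpow, mul_assoc, ← zpow_add₀ hq0.ne', mul_pow, neg_sq, sq (sgn ε), sgn_mul_self, one_mul,
      ← zpow_natCast, ← zpow_mul]
    congr 1
    push_cast
    ring
  rw [e2, ← pow_mul q 2 2] at hinf
  rw [← hinf]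
  simp only [one_pow, ← pow_mul]
  rw [mul_comm 2 (n * (n - 1) / 2)]
  ring

/-- Conjugation by the weight removes the square roots from the Jacobi matrix, leaving the
coefficients of the Meixner difference equation. -/
theorem sqrt_one_sub_mul_coeffWeight (hq0 : 0 < q) (hq1 : q < 1) (ε : ℤˣ) {p : ℤ} {n k : ℕ}
    (hk : (k : ℤ) = p + n) :
    offDiag q n k * coeffWeight q ε p (n + 1) =
      sgn ε * (q ^ 2) ^ n * coeffWeight q ε p n ∧
    offDiag q n k * coeffWeight q ε p n =
      sgn ε * (1 - (q ^ 2) ^ (n + 1)) * (1 - (q ^ 2) ^ (2 * (k + 1))) *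
        coeffWeight q ε p (n + 1) := by
  have hQ0 : 0 < q ^ 2 := by positivity
  have hQ1 : q ^ 2 < 1 := pow_lt_one₀ hq0.le hq1 two_ne_zero
  have hQ41 : q ^ 4 < 1 := pow_lt_one₀ hq0.le hq1 (by norm_num)
  have h1 : 0 < 1 - (q ^ 2) ^ (n + 1) := by
    have := pow_lt_one₀ hQ0.le hQ1 (n := n + 1) (by omega); linarith
  have h2 : 0 < 1 - (q ^ 2) ^ (2 * (k + 1)) := by
    have := pow_lt_one₀ hQ0.le hQ1 (n := 2 * (k + 1)) (by omega); linarith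
  have h3 : 0 < qPoch (q ^ 2) (q ^ 2) n := qPoch_pos hQ0.le hQ1 hQ1 n
  have e1 : qPochInf (q ^ (4 * p + 4 * n + 4)) (q ^ 4) = (1 - (q ^ 2) ^ (2 * (k + 1))) *
      qPochInf (q ^ (4 * p + 4 * (n + 1 : ℕ) + 4)) (q ^ 4) := by
    rw [qPochInf_eq (by positivity) hQ41]
    congr 2
    · rw [← pow_mul, ← zpow_natCast]
      congr 1
      push_cast
      linarith
    · rw [← zpow_natCast q 4, ← zpow_add₀ hq0.ne']
      congr 1
      push_cast
      ring
  have e2 : qPoch (q ^ 2) (q ^ 2) (n + 1) =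
      (1 - (q ^ 2) ^ (n + 1)) * qPoch (q ^ 2) (q ^ 2) n := by
    rw [qPoch_succ, ← pow_succ, mul_comm]
  have s1 := Real.mul_self_sqrt h1.le
  have s2 := Real.mul_self_sqrt h2.le
  have s1p := (Real.sqrt_pos.2 h1).ne'
  have s2p := (Real.sqrt_pos.2 h2).ne'
  have s3p := (Real.sqrt_pos.2 h3).ne'
  have hs := sgn_mul_self ε
  rw [coeffWeight, coeffWeight, offDiag, e1, e2, Real.sqrt_mul h2.le, Real.sqrt_mul h1.le,
    Nat.triangle_succ, pow_add q, pow_succ (sgn ε)]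
  generalize √(qPochInf (q ^ (4 * p + 4 * (n + 1 : ℕ) + 4)) (q ^ 4)) = V
  generalize √(qPoch (q ^ 2) (q ^ 2) n) = D at *
  generalize √(1 - (q ^ 2) ^ (n + 1)) = S at *
  generalize √(1 - (q ^ 2) ^ (2 * (k + 1))) = S' at *
  rw [← s1, ← s2]
  constructor
  · rw [← pow_mul, mul_comm 2 n, pow_mul]
    field_simp
  · field_simp
    linear_combination -(sgn ε ^ n * V) * hs

/-- This is `meixner_difference` with bQ^n = -ε q^{2k}; the factors 1 + bQ^n and 1 - bQ^n multiply
to 1 - q^{4k}. -/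
theorem coeffPoly_recurrence (hq0 : 0 < q) (ε : ℤˣ) {p : ℤ} (r : ℕ) {n k : ℕ}
    (hk : (k : ℤ) = p + n) :
    (1 - (q ^ 2) ^ n) * (1 - (q ^ 2) ^ (2 * k)) * coeffPoly q ε p r (n - 1) +
      sgn ε * onDiag q n k * coeffPoly q ε p r n + (q ^ 2) ^ n * coeffPoly q ε p r (n + 1) =
      q ^ (2 * r) * coeffPoly q ε p r n := by
  have hQ0 : 0 < q ^ 2 := by positivity
  have h := meixner_difference hQ0 r (-sgn ε * q ^ (2 * p)) one_ne_zero n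
  have hs := sgn_mul_self ε
  have e1 : (q ^ 2) ^ n * q ^ (2 * p) = q ^ (2 * k) := by
    rw [← pow_mul, ← zpow_natCast, ← zpow_natCast, ← zpow_add₀ hq0.ne']
    congr 1
    push_cast
    linarith
  have e2 : (q ^ 2) ^ (2 * k) = q ^ (2 * k) * q ^ (2 * k) := by ring
  have e3 : (q ^ 2) ^ n = q ^ n * q ^ n := by ring
  have e4 : (q ^ 2) ^ r = q ^ (2 * r) := (pow_mul q 2 r).symm
  simp only [coeffPoly, onDiag]
  rw [e2, ← e3, ← e1]
  rw [e4] at h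
  simp only [pow_succ (q ^ 2) n] at h
  generalize meixner (q ^ 2) r (-sgn ε * q ^ (2 * p)) 1 (n - 1) = u0 at *
  generalize meixner (q ^ 2) r (-sgn ε * q ^ (2 * p)) 1 (n + 1) = u2 at *
  generalize meixner (q ^ 2) r (-sgn ε * q ^ (2 * p)) 1 n = u1 at *
  generalize (q ^ 2) ^ n = X at *
  generalize q ^ (2 * p) = Z at *
  linear_combination -h + (1 - X) * X ^ 2 * Z ^ 2 * u0 * hs

theorem coeffQ_recurrence (hq0 : 0 < q) (hq1 : q < 1) {ε : ℤˣ} {p : ℤ} {r : ℕ}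
    (h : p + r ∈ indexJ ε) {n k : ℕ} (hk : (k : ℤ) = p + n) :
    (if n = 0 ∨ k = 0 then 0 else offDiag q (n - 1) (k - 1) * coeffQ q ε p r (n - 1)) +
      onDiag q n k * coeffQ q ε p r n + offDiag q n k * coeffQ q ε p r (n + 1) =
      sgn ε * q ^ (2 * r) * coeffQ q ε p r n := by
  have hr := coeffPoly_recurrence hq0 ε r hk
  have hs := sgn_mul_self ε
  have h1 := (sqrt_one_sub_mul_coeffWeight hq0 hq1 ε hk).1
  -- At the start of the chain n = 0 or k = 0, and one of the factors 1 - Q^n, 1 - Q^{2k} vanishes,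
  -- so the boundary row fits the general formula.
  have h0 : (if n = 0 ∨ k = 0 then 0 else offDiag q (n - 1) (k - 1) * coeffQ q ε p r (n - 1)) =
      coeffConst q ε p r * (sgn ε * (1 - (q ^ 2) ^ n) * (1 - (q ^ 2) ^ (2 * k)) *
        coeffWeight q ε p n) * coeffPoly q ε p r (n - 1) := by
    split_ifs with h0
    · rcases h0 with rfl | rfl <;> simp
    · obtain ⟨n, rfl⟩ : ∃ m, n = m + 1 := ⟨n - 1, by omega⟩
      obtain ⟨k, rfl⟩ : ∃ m, k = m + 1 := ⟨k - 1, by omega⟩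
      rw [← (sqrt_one_sub_mul_coeffWeight hq0 hq1 ε (n := n) (k := k)
        (by push_cast at hk; linarith)).2, coeffQ_eq hq0 hq1 h]
      simp only [Nat.add_sub_cancel]
      ring
  rw [h0, coeffQ_eq hq0 hq1 h, coeffQ_eq hq0 hq1 h]
  linear_combination (coeffConst q ε p r * coeffPoly q ε p r (n + 1)) * h1 +
    (sgn ε * coeffConst q ε p r * coeffWeight q ε p n) * hr -
    (coeffConst q ε p r * coeffWeight q ε p n * onDiag q n k * coeffPoly q ε p r n) * hs

end Coefficients

/-! ### Chains and the orthonormal family of eigenvectors. -/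

section Eigenvectors

open Filter Topology
open scoped InnerProductSpace

/-- The basis vectors of `ℓ²(ℕ) ⊗ ℓ²(ℤ) ⊗ ℓ²(ℕ)` spanning the invariant subspace with labels `t, p`,
that is, the `e_n ⊗ e_{t-n} ⊗ e_{p+n}` with `n ≥ 0` and `p + n ≥ 0`. -/
def chainIdx (t p : ℤ) (j : ℕ) : (ℕ × ℤ) × ℕ :=
  (((-p).toNat + j, t - ((-p).toNat + j : ℕ)), p.toNat + j)

theorem chainIdx_injective (t p : ℤ) : Function.Injective (chainIdx t p) := fun a b h => by
  simp only [chainIdx, Prod.mk.injEq] at h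
  omega

/-- Every basis index lies on exactly one chain, at position min(n, k). -/
theorem mem_range_chainIdx {t p : ℤ} {i : (ℕ × ℤ) × ℕ} :
    i ∈ Set.range (chainIdx t p) ↔ (i.1.1 + i.1.2 = t ∧ (i.2 : ℤ) - i.1.1 = p) := by
  obtain ⟨⟨n, m⟩, k⟩ := i
  constructor
  · rintro ⟨j, hj⟩
    simp only [chainIdx, Prod.mk.injEq] at hj
    simp only
    omega
  · rintro ⟨h1, h2⟩
    simp only at h1 h2
    refine ⟨min n k, ?_⟩
    simp only [chainIdx, Prod.mk.injEq]
    omega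

variable {q : ℝ}

/-- The coordinates of the eigenvector of `α̃₊(W)`. -/
noncomputable def eigenCoord (q : ℝ) (ε : ℤˣ) (t p : ℤ) (r : ℕ) (i : (ℕ × ℤ) × ℕ) : ℂ :=
  if i.1.1 + i.1.2 = t ∧ (i.2 : ℤ) - i.1.1 = p then (coeffQ q ε p r i.1.1 : ℂ) else 0

theorem eigenCoord_chainIdx (ε : ℤˣ) (t p : ℤ) (r j : ℕ) :
    eigenCoord q ε t p r (chainIdx t p j) = coeffQ q ε p r ((-p).toNat + j) :=
  if_pos (mem_range_chainIdx.1 ⟨j, rfl⟩)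

theorem eigenCoord_of_notMem {ε : ℤˣ} {t p : ℤ} {r : ℕ} {i : (ℕ × ℤ) × ℕ}
    (h : i ∉ Set.range (chainIdx t p)) : eigenCoord q ε t p r i = 0 :=
  if_neg (mt mem_range_chainIdx.2 h)

theorem hasSum_eigenCoord_chainIdx (hq0 : 0 < q) (hq1 : q < 1) {ε : ℤˣ} (t : ℤ) {p : ℤ} {r : ℕ}
    (h : p + r ∈ indexJ ε) :
    HasSum (fun j => ‖eigenCoord q ε t p r (chainIdx t p j)‖ ^ 2) 1 := by
  have h1 := hasSum_coeffQ_sq hq0 hq1 h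
  rw [← (add_right_injective (-p).toNat).hasSum_iff (fun n hn => ?_)] at h1
  · refine h1.congr_fun ?_
    intro j
    rw [eigenCoord_chainIdx, Complex.norm_real, Real.norm_eq_abs, sq_abs]
    rfl
  · rw [coeffQ_eq_zero hq0 hq1 ε r, zero_pow two_ne_zero]
    by_contra hc
    exact hn ⟨n - (-p).toNat, by dsimp only; omega⟩

theorem hasSum_eigenCoord (hq0 : 0 < q) (hq1 : q < 1) {ε : ℤˣ} (t : ℤ) {p : ℤ} {r : ℕ}
    (h : p + r ∈ indexJ ε) : HasSum (fun i => ‖eigenCoord q ε t p r i‖ ^ 2) 1 := by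
  rw [← (chainIdx_injective t p).hasSum_iff (fun i hi => by simp [eigenCoord_of_notMem hi])]
  exact hasSum_eigenCoord_chainIdx hq0 hq1 t h

/-- The eigenvector `ξ_{r,ε}^{(t,p)}` of `α̃₊(W)`. -/
noncomputable def eigenVec (hq0 : 0 < q) (hq1 : q < 1) {ε : ℤˣ} (t : ℤ) {p : ℤ} {r : ℕ}
    (h : p + r ∈ indexJ ε) : L2 ((ℕ × ℤ) × ℕ) :=
  ⟨eigenCoord q ε t p r, (memlp_two_iff _).2 (hasSum_eigenCoord hq0 hq1 t h).summable⟩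

theorem eigenVec_apply (hq0 : 0 < q) (hq1 : q < 1) {ε : ℤˣ} (t : ℤ) {p : ℤ} {r : ℕ}
    (h : p + r ∈ indexJ ε) (i : (ℕ × ℤ) × ℕ) :
    eigenVec hq0 hq1 t h i = eigenCoord q ε t p r i := rfl

theorem norm_eigenVec (hq0 : 0 < q) (hq1 : q < 1) {ε : ℤˣ} (t : ℤ) {p : ℤ} {r : ℕ}
    (h : p + r ∈ indexJ ε) : ‖eigenVec hq0 hq1 t h‖ = 1 := by
  have h1 := L2_norm_sq (eigenVec hq0 hq1 t h)
  simp only [eigenVec_apply] at h1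
  rw [(hasSum_eigenCoord hq0 hq1 t h).tsum_eq] at h1
  exact (pow_eq_one_iff_of_nonneg (norm_nonneg _) two_ne_zero).1 h1

theorem hasSum_eigenVec (hq0 : 0 < q) (hq1 : q < 1) {ε : ℤˣ} (t : ℤ) {p : ℤ} {r : ℕ}
    (h : p + r ∈ indexJ ε) :
    HasSum (fun n : ℕ => (coeffQ q ε p r n : ℂ) • basisVec n (t - n) (p + n))
      (eigenVec hq0 hq1 t h) := by
  have h1 := lp.hasSum_single (p := 2) (by norm_num) (eigenVec hq0 hq1 t h)
  rw [← (chainIdx_injective t p).hasSum_iff (fun i hi => by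
    rw [eigenVec_apply, eigenCoord_of_notMem hi]; exact map_zero (lp.lsingle (𝕜 := ℂ) 2 i))] at h1
  rw [← (add_right_injective (-p).toNat).hasSum_iff]
  · refine h1.congr_fun ?_
    intro j
    have hk : (0 : ℤ) ≤ p + ((-p).toNat + j : ℕ) := by omega
    have hk2 : (p + ((-p).toNat + j : ℕ)).toNat = p.toNat + j := by omega
    simp only [Function.comp_apply]
    rw [basisVec, if_pos hk, hk2, eigenVec_apply, eigenCoord_chainIdx]
    ext i
    rw [L2_smul_apply, L2_single_apply, lp.single_apply, Pi.single_apply, chainIdx]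
    simp
  · intro n hn
    have : ¬(0 ≤ p + (n : ℤ)) := fun hc => hn ⟨n - (-p).toNat, by dsimp only; omega⟩
    rw [basisVec, if_neg this, smul_zero]

theorem alphaTildeW_eigenVec (hq0 : 0 < q) (hq1 : q < 1) {ε : ℤˣ} (t : ℤ) {p : ℤ} {r : ℕ}
    (h : p + r ∈ indexJ ε) :
    alphaTildeW q hq0 hq1 1 (eigenVec hq0 hq1 t h) =
      ((sgn ε * q ^ (2 * r) : ℝ) : ℂ) • eigenVec hq0 hq1 t h := by
  ext ⟨⟨n, m⟩, k⟩
  rw [alphaTildeW_apply, L2_smul_apply]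
  simp only [eigenVec_apply, eigenCoord]
  by_cases hs : (n : ℤ) + m = t ∧ (k : ℤ) - n = p
  · have hr := coeffQ_recurrence hq0 hq1 h (n := n) (k := k) (by omega)
    have hs2 : ((n + 1 : ℕ) : ℤ) + (m - 1) = t ∧ ((k + 1 : ℕ) : ℤ) - (n + 1 : ℕ) = p := by omega
    rw [if_pos hs, if_pos hs2, ← Complex.ofReal_mul (sgn ε * q ^ (2 * r)), ← hr]
    push_cast
    congr 2
    split_ifs with h1 h2
    · rfl
    · push_cast; rfl
    · omega
  · have hs2 : ¬(((n + 1 : ℕ) : ℤ) + (m - 1) = t ∧ ((k + 1 : ℕ) : ℤ) - (n + 1 : ℕ) = p) := by omega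
    rw [if_neg hs, if_neg hs2]
    simp only [mul_zero, add_zero]
    split_ifs with h1 h2
    · rfl
    · omega
    · simp

theorem eigenvalue_injective (hq0 : 0 < q) (hq1 : q < 1) {ε ε' : ℤˣ} {r r' : ℕ}
    (h : sgn ε * q ^ (2 * r) = sgn ε' * q ^ (2 * r')) : ε = ε' ∧ r = r' := by
  have h1 : 0 < q ^ (2 * r) := by positivity
  have h2 : 0 < q ^ (2 * r') := by positivity
  have h3 := congrArg abs h
  rw [abs_mul, abs_mul, abs_sgn, abs_sgn, one_mul, one_mul, abs_of_pos h1, abs_of_pos h2] at h3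
  have h4 := pow_right_injective₀ hq0 hq1.ne h3
  refine ⟨?_, by omega⟩
  rw [h3] at h
  have h5 := mul_right_cancel₀ h2.ne' h
  rcases Int.units_eq_one_or ε with rfl | rfl <;> rcases Int.units_eq_one_or ε' with rfl | rfl
  · rfl
  · rw [sgn_one, sgn_neg_one] at h5; norm_num at h5
  · rw [sgn_one, sgn_neg_one] at h5; norm_num at h5
  · rfl

/-- Labels `(ε, r, t, p)` of the eigenvectors. -/
abbrev EigenLabel : Type := {x : (ℤˣ × ℕ) × (ℤ × ℤ) // x.2.2 + x.1.2 ∈ indexJ x.1.1}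

/-- The family of all eigenvectors. -/
noncomputable def eigenFamily (hq0 : 0 < q) (hq1 : q < 1) (x : EigenLabel) : L2 ((ℕ × ℤ) × ℕ) :=
  eigenVec hq0 hq1 x.1.2.1 x.2

/-- The eigenvalue of an eigenvector. -/
noncomputable def eigenLabelValue (q : ℝ) (x : EigenLabel) : ℝ := sgn x.1.1.1 * q ^ (2 * x.1.1.2)

theorem alphaTildeW_eigenFamily (hq0 : 0 < q) (hq1 : q < 1) (x : EigenLabel) :
    alphaTildeW q hq0 hq1 1 (eigenFamily hq0 hq1 x) =
      (eigenLabelValue q x : ℂ) • eigenFamily hq0 hq1 x :=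
  alphaTildeW_eigenVec hq0 hq1 x.1.2.1 x.2

theorem inner_eigenFamily_alphaTildeW (hq0 : 0 < q) (hq1 : q < 1) (x : EigenLabel)
    (y : L2 ((ℕ × ℤ) × ℕ)) :
    ⟪eigenFamily hq0 hq1 x, alphaTildeW q hq0 hq1 1 y⟫_ℂ =
      eigenLabelValue q x * ⟪eigenFamily hq0 hq1 x, y⟫_ℂ := by
  rw [← alphaTildeW_inner, alphaTildeW_eigenFamily, inner_smul_left, Complex.conj_ofReal]

/-- On a common chain, distinct labels have distinct eigenvalues and self-adjointness applies;
otherwise the supports are disjoint. -/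
theorem orthonormal_eigenFamily (hq0 : 0 < q) (hq1 : q < 1) :
    Orthonormal ℂ (eigenFamily hq0 hq1) := by
  refine ⟨fun x => norm_eigenVec hq0 hq1 x.1.2.1 x.2, fun x y hxy => ?_⟩
  by_cases htp : x.1.2 = y.1.2
  · have hne : eigenLabelValue q x ≠ eigenLabelValue q y := fun h => by
      obtain ⟨h1, h2⟩ := eigenvalue_injective hq0 hq1 h
      exact hxy (Subtype.ext (Prod.ext (Prod.ext h1 h2) htp))
    have h := inner_eigenFamily_alphaTildeW hq0 hq1 x (eigenFamily hq0 hq1 y)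
    rw [alphaTildeW_eigenFamily, inner_smul_right] at h
    have h2 : ((eigenLabelValue q x : ℂ) - eigenLabelValue q y) *
        ⟪eigenFamily hq0 hq1 x, eigenFamily hq0 hq1 y⟫_ℂ = 0 := by
      rw [sub_mul, ← h, sub_self]
    refine (mul_eq_zero.1 h2).resolve_left ?_
    rw [← Complex.ofReal_sub]
    exact_mod_cast sub_ne_zero.2 hne
  · simp only [lp.inner_eq_tsum]
    refine (tsum_congr fun i => ?_).trans tsum_zero
    have hx : eigenFamily hq0 hq1 x i = eigenCoord q x.1.1.1 x.1.2.1 x.1.2.2 x.1.1.2 i := rfl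
    have hy : eigenFamily hq0 hq1 y i = eigenCoord q y.1.1.1 y.1.2.1 y.1.2.2 y.1.1.2 i := rfl
    rw [hx, hy]
    by_cases hi : i ∈ Set.range (chainIdx x.1.2.1 x.1.2.2)
    · by_cases hj : i ∈ Set.range (chainIdx y.1.2.1 y.1.2.2)
      · rw [mem_range_chainIdx] at hi hj
        exact absurd (Prod.ext (hi.1.symm.trans hj.1) (hi.2.symm.trans hj.2)) htp
      · rw [eigenCoord_of_notMem hj, inner_zero_right]
    · rw [eigenCoord_of_notMem hi, inner_zero_left]

end Eigenvectors

/-! ### Completeness by a Hilbert-Schmidt count and triviality of the kernel. -/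

section Completeness

open Filter Topology
open scoped InnerProductSpace

/-- Equality in Bessel's inequality. -/
theorem Orthonormal.inner_eq_zero_of_norm_sq_le {H ι : Type*} [NormedAddCommGroup H]
    [InnerProductSpace ℂ H] {v : ι → H} (hv : Orthonormal ℂ v) {w x : H}
    (hw : ‖w‖ ^ 2 ≤ ∑' i, ‖⟪v i, w⟫_ℂ‖ ^ 2) (hx : ∀ i, ⟪v i, x⟫_ℂ = 0) : ⟪x, w⟫_ℂ = 0 := by
  rcases eq_or_ne x 0 with rfl | hx0
  · exact inner_zero_left _
  set α : ℂ := ⟪x, w⟫_ℂ / ⟪x, x⟫_ℂ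
  have hxx : ⟪x, x⟫_ℂ ≠ 0 := inner_self_ne_zero.2 hx0
  have h1 : ⟪x, w - α • x⟫_ℂ = 0 := by
    rw [inner_sub_right, inner_smul_right, div_mul_cancel₀ _ hxx, sub_self]
  have h2 : ∀ i, ⟪v i, w - α • x⟫_ℂ = ⟪v i, w⟫_ℂ := fun i => by
    rw [inner_sub_right, inner_smul_right, hx, mul_zero, sub_zero]
  -- Removing the component of w along x leaves all inner products with v unchanged, so Bessel gives
  -- ‖w‖ ≤ ‖w - αx‖, and Pythagoras forces αx = 0.
  have h3 := hv.tsum_inner_products_le (x := w - α • x)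
  simp only [h2] at h3
  have h4 := norm_add_sq_eq_norm_sq_add_norm_sq_of_inner_eq_zero (𝕜 := ℂ) (α • x) (w - α • x)
    (by rw [inner_smul_left, h1, mul_zero])
  rw [add_sub_cancel, ← sq, ← sq, ← sq] at h4
  have h5 : ‖α • x‖ ^ 2 ≤ 0 := by linarith
  have h6 : α • x = 0 := norm_eq_zero.1 (pow_eq_zero_iff two_ne_zero |>.1
    (le_antisymm h5 (sq_nonneg _)))
  rw [h6, sub_zero] at h1
  exact h1

/-- If the eigenvalues of an orthonormal family of eigenvectors exhaust the Hilbert-Schmidt norm,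
the operator vanishes on the orthogonal complement of the family. -/
theorem Orthonormal.inner_eq_zero_of_hasSum_sq {H ι : Type*} [NormedAddCommGroup H]
    [InnerProductSpace ℂ H] {v : ι → H} (hv : Orthonormal ℂ v) (A : H →L[ℂ] H) (lam : ι → ℝ)
    (hA : ∀ i y, ⟪v i, A y⟫_ℂ = lam i * ⟪v i, y⟫_ℂ) (e : ℕ → H)
    (he : ∀ i, HasSum (fun j => ‖⟪v i, e j⟫_ℂ‖ ^ 2) 1) {Λ : ℝ}
    (h1 : HasSum (fun i => lam i ^ 2) Λ) (h2 : HasSum (fun j => ‖A (e j)‖ ^ 2) Λ) {x : H}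
    (hx : ∀ i, ⟪v i, x⟫_ℂ = 0) (j : ℕ) : ⟪x, A (e j)⟫_ℂ = 0 := by
  -- This double series is summed in both orders. Over j it gives λ_i², so the total is Λ; over i it
  -- is at most ‖A e_j‖², and these bounds also add up to Λ. Bessel is therefore an equality for
  -- every j.
  set F : ι × ℕ → ℝ := fun c => ‖⟪v c.1, A (e c.2)⟫_ℂ‖ ^ 2 with hF
  have hFib : ∀ i, HasSum (fun j => F (i, j)) (lam i ^ 2) := fun i => by
    have := (he i).mul_left (lam i ^ 2)
    rw [mul_one] at this
    refine this.congr_fun ?_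
    intro j
    simp only [hF]
    rw [hA, norm_mul, mul_pow, Complex.norm_real, Real.norm_eq_abs, sq_abs]
  have hFs : Summable F := by
    rw [summable_prod_of_nonneg (fun c => by positivity)]
    refine ⟨fun i => (hFib i).summable, ?_⟩
    simp only [(hFib _).tsum_eq]
    exact h1.summable
  have hFsum : HasSum F Λ := by
    have := hFs.hasSum
    rwa [(this.prod_fiberwise hFib).unique h1] at this
  have hS : HasSum (fun j => ∑' i, ‖⟪v i, A (e j)⟫_ℂ‖ ^ 2) Λ := by
    have hsw : HasSum (F ∘ (Equiv.prodComm ℕ ι)) Λ := (Equiv.prodComm ℕ ι).hasSum_iff.2 hFsum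
    exact hsw.prod_fiberwise fun j => (hsw.summable.prod_factor j).hasSum
  have hdiff := h2.sub hS
  rw [sub_self, hasSum_zero_iff_of_nonneg (fun j =>
    sub_nonneg.2 (hv.tsum_inner_products_le _))] at hdiff
  have hj := congrFun hdiff j
  simp only [Pi.zero_apply] at hj
  exact hv.inner_eq_zero_of_norm_sq_le (by linarith) hx

/-- A bounded solution of a three-term recurrence with rapidly decreasing coefficients vanishes. -/
theorem eq_zero_of_recurrence {c d : ℕ → ℝ} (hc : ∀ j, 0 < c j) {ρ : ℝ} (hρ0 : 0 ≤ ρ) (hρ : ρ < 1)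
    (hev : ∀ᶠ j in atTop, |d (j + 1)| + c (j + 1) ≤ ρ * c j) {x : ℕ → ℂ} {B : ℝ}
    (hB : ∀ j, ‖x j‖ ≤ B)
    (hrec : ∀ j, (c j : ℂ) * x j + d (j + 1) * x (j + 1) + c (j + 1) * x (j + 2) = 0) (j : ℕ) :
    x j = 0 := by
  obtain ⟨N, hN⟩ := eventually_atTop.1 hev
  have hstep : ∀ j, c j * ‖x j‖ ≤ |d (j + 1)| * ‖x (j + 1)‖ + c (j + 1) * ‖x (j + 2)‖ := fun j => by
    have h1 : (c j : ℂ) * x j = -(d (j + 1) * x (j + 1) + c (j + 1) * x (j + 2)) := by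
      linear_combination hrec j
    have h2 := congrArg norm h1
    rw [norm_neg, norm_mul, Complex.norm_real, Real.norm_eq_abs, abs_of_pos (hc j)] at h2
    rw [h2]
    refine (norm_add_le _ _).trans ?_
    rw [norm_mul, norm_mul, Complex.norm_real, Complex.norm_real, Real.norm_eq_abs,
      Real.norm_eq_abs, abs_of_pos (hc (j + 1))]
  -- For j ≥ N, ‖x j‖ is at most ρ times a common bound of the next two entries, so any uniform
  -- bound on the tail improves by the factor ρ.
  have hind : ∀ i, ∀ j ≥ N, ‖x j‖ ≤ ρ ^ i * B := by
    intro i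
    induction i with
    | zero => intro j _; simpa using hB j
    | succ i ih =>
      intro j hj
      have h1 := ih (j + 1) (by omega)
      have h2 := ih (j + 2) (by omega)
      have hBi : 0 ≤ ρ ^ i * B := (norm_nonneg _).trans h1
      refine le_of_mul_le_mul_left ?_ (hc j)
      calc c j * ‖x j‖ ≤ |d (j + 1)| * ‖x (j + 1)‖ + c (j + 1) * ‖x (j + 2)‖ := hstep j
        _ ≤ |d (j + 1)| * (ρ ^ i * B) + c (j + 1) * (ρ ^ i * B) :=
            add_le_add (mul_le_mul_of_nonneg_left h1 (abs_nonneg _))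
              (mul_le_mul_of_nonneg_left h2 (hc _).le)
        _ = (|d (j + 1)| + c (j + 1)) * (ρ ^ i * B) := by ring
        _ ≤ ρ * c j * (ρ ^ i * B) := mul_le_mul_of_nonneg_right (hN j hj) hBi
        _ = c j * (ρ ^ (i + 1) * B) := by ring
  have htail : ∀ j ≥ N, x j = 0 := fun j hj => by
    have : Tendsto (fun i : ℕ => ρ ^ i * B) atTop (𝓝 0) := by
      simpa using (tendsto_pow_atTop_nhds_zero_of_lt_one hρ0 hρ).mul_const B
    exact norm_le_zero_iff.1 (ge_of_tendsto' this fun i => hind i j hj)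
  have hdown : ∀ D, ∀ j, j + D ≥ N → x j = 0 := by
    intro D
    induction D with
    | zero => exact fun j hj => htail j hj
    | succ D ih =>
      intro j hj
      have h := hrec j
      rw [ih (j + 1) (by omega), ih (j + 2) (by omega), mul_zero, mul_zero, add_zero, add_zero] at h
      exact (mul_eq_zero.1 h).resolve_left (by exact_mod_cast (hc j).ne')
  exact hdown N j (by omega)

variable {q : ℝ}

theorem offDiag_pos (hq0 : 0 < q) (hq1 : q < 1) (n k : ℕ) : 0 < offDiag q n k := by
  have hQ1 : q ^ 2 < 1 := pow_lt_one₀ hq0.le hq1 two_ne_zero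
  have h1 := pow_lt_one₀ (by positivity) hQ1 (n := n + 1) (by omega)
  have h2 := pow_lt_one₀ (by positivity) hQ1 (n := 2 * (k + 1)) (by omega)
  have := Real.sqrt_pos.2 (sub_pos.2 h1)
  have := Real.sqrt_pos.2 (sub_pos.2 h2)
  rw [offDiag]
  positivity

theorem offDiag_le (hq0 : 0 < q) (n k : ℕ) : offDiag q n k ≤ q ^ n := by
  have h1 : ∀ m, √(1 - (q ^ 2) ^ m) ≤ 1 := fun m =>
    (le_abs_self _).trans (abs_sqrt_one_sub_le q m)
  rw [offDiag, mul_assoc]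
  exact mul_le_of_le_one_right (by positivity)
    (mul_le_one₀ (h1 _) (Real.sqrt_nonneg _) (h1 _))

theorem abs_onDiag_le (hq0 : 0 < q) (hq1 : q < 1) (n k : ℕ) : |onDiag q n k| ≤ q ^ (2 * k) := by
  have hX1 : q ^ n ≤ 1 := pow_le_one₀ hq0.le hq1.le
  have hX0 : 0 < q ^ n := by positivity
  have hXX : q ^ n * q ^ n ≤ 1 := mul_le_one₀ hX1 hX0.le hX1
  have hQ : q ^ 2 ≤ 1 := pow_le_one₀ hq0.le hq1.le
  have hQ0 : 0 < q ^ 2 := by positivity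
  rw [onDiag, abs_mul, abs_of_pos (pow_pos hq0 (2 * k))]
  refine mul_le_of_le_one_left (by positivity) (abs_le.2 ⟨?_, ?_⟩)
  · nlinarith [mul_pos hX0 hX0]
  · nlinarith [mul_pos hX0 hX0]

/-- Along a chain off-diagonal entries decay like q^j and diagonal ones at least like q^{2j}, so the
ratio is asymptotically at most q; (1 + q)/2 is a number strictly between q and 1. -/
theorem eventually_offDiag_ratio (hq0 : 0 < q) (hq1 : q < 1) (n0 k0 : ℕ) :
    ∀ᶠ j in atTop, |onDiag q (n0 + (j + 1)) (k0 + (j + 1))| + offDiag q (n0 + (j + 1)) (k0 + (j + 1))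
      ≤ (1 + q) / 2 * offDiag q (n0 + j) (k0 + j) := by
  have hpow : Tendsto (fun j : ℕ => q ^ j) atTop (𝓝 0) :=
    tendsto_pow_atTop_nhds_zero_of_lt_one hq0.le hq1
  have hL : Tendsto (fun j : ℕ => q ^ j / q ^ n0 + q) atTop (𝓝 (0 / q ^ n0 + q)) :=
    (hpow.div_const _).add_const q
  have hsq : ∀ f : ℕ → ℕ, Tendsto f atTop atTop →
      Tendsto (fun j : ℕ => √(1 - (q ^ 2) ^ f j)) atTop (𝓝 1) := fun f hf => by
    have h1 : Tendsto (fun j : ℕ => (q ^ 2) ^ j) atTop (𝓝 0) :=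
      tendsto_pow_atTop_nhds_zero_of_lt_one (by positivity) (pow_lt_one₀ hq0.le hq1 two_ne_zero)
    simpa using ((h1.comp hf).const_sub 1).sqrt
  have hR : Tendsto (fun j : ℕ => (1 + q) / 2 *
      (√(1 - (q ^ 2) ^ (n0 + j + 1)) * √(1 - (q ^ 2) ^ (2 * (k0 + j + 1))))) atTop
      (𝓝 ((1 + q) / 2 * (1 * 1))) :=
    ((hsq _ (tendsto_atTop_mono (fun j => by dsimp only [id]; omega) tendsto_id)).mul
      (hsq _ (tendsto_atTop_mono (fun j => by dsimp only [id]; omega) tendsto_id))).const_mul _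
  have hlt : 0 / q ^ n0 + q < (1 + q) / 2 * (1 * 1) := by
    rw [zero_div]; linarith
  filter_upwards [hL.eventually_lt hR hlt] with j hj
  have hn : 0 < q ^ (n0 + j) := by positivity
  have h1 := abs_onDiag_le hq0 hq1 (n0 + (j + 1)) (k0 + (j + 1))
  have h2 := offDiag_le hq0 (n0 + (j + 1)) (k0 + (j + 1))
  have h3 : q ^ (2 * (k0 + (j + 1))) ≤ q ^ (2 * j) :=
    pow_le_pow_of_le_one hq0.le hq1.le (by omega)
  have h4 : q ^ (2 * j) = q ^ (n0 + j) * (q ^ j / q ^ n0) := by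
    field_simp
    ring
  have h5 : q ^ (n0 + (j + 1)) = q ^ (n0 + j) * q := by ring
  calc _ ≤ q ^ (n0 + j) * (q ^ j / q ^ n0) + q ^ (n0 + j) * q := by linarith
    _ = q ^ (n0 + j) * (q ^ j / q ^ n0 + q) := by ring
    _ ≤ q ^ (n0 + j) * ((1 + q) / 2 *
      (√(1 - (q ^ 2) ^ (n0 + j + 1)) * √(1 - (q ^ 2) ^ (2 * (k0 + j + 1))))) :=
        mul_le_mul_of_nonneg_left hj.le hn.le
    _ = _ := by rw [offDiag]; ring

theorem sq_offDiag (hq0 : 0 < q) (hq1 : q < 1) (n k : ℕ) :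
    offDiag q n k ^ 2 = (q ^ 2) ^ n * (1 - (q ^ 2) ^ (n + 1)) * (1 - (q ^ 2) ^ (2 * (k + 1))) := by
  have hQ1 : q ^ 2 ≤ 1 := pow_le_one₀ hq0.le hq1.le
  have h : ∀ m, √(1 - (q ^ 2) ^ m) ^ 2 = 1 - (q ^ 2) ^ m := fun m =>
    Real.sq_sqrt (sub_nonneg.2 (pow_le_one₀ (by positivity) hQ1))
  rw [offDiag, mul_pow, mul_pow, h, h]
  ring

/-- The Hilbert-Schmidt norm of `α̃₊(W)` on each of its invariant subspaces. -/
theorem hasSum_norm_alphaTildeW_sq (hq0 : 0 < q) (hq1 : q < 1) (t p : ℤ) :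
    HasSum (fun j => ‖alphaTildeW q hq0 hq1 1 (lp.single 2 (chainIdx t p j) (1 : ℂ))‖ ^ 2)
      ((1 + ((q ^ 2) ^ (-p).toNat) ^ 2) / (1 - (q ^ 2) ^ 2)) := by
  have hQ0 : 0 < q ^ 2 := by positivity
  have hQ1 : q ^ 2 < 1 := pow_lt_one₀ hq0.le hq1 two_ne_zero
  set n0 := (-p).toNat
  set k0 := p.toNat
  have hnk : n0 = 0 ∨ k0 = 0 := by omega
  set Q := q ^ 2 with hQ
  have hQ2 : 1 - Q ≠ 0 := by linarith
  have hQ3 : 1 - Q ^ 2 ≠ 0 := by nlinarith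
  -- An antidifference: the squared column norm is a polynomial in X = Q^n and Z = Q^k, a step along
  -- the chain multiplies X^a Z^b by Q^{a+b}, so each monomial is divided by 1 - Q^{a+b}.
  set T : ℝ → ℝ → ℝ := fun X Z => X * (1 + Q) / (Q * (1 - Q)) - X ^ 2 * (1 + Q ^ 2) / (Q * (1 - Q ^ 2))
    + Z ^ 2 / (1 - Q ^ 2) - X * Z ^ 2 * (1 + Q) / (Q * (1 - Q))
    + X ^ 2 * Z ^ 2 * (1 + Q + Q ^ 2) / (Q * (1 - Q ^ 2)) with hT
  have hterm : ∀ j, ‖alphaTildeW q hq0 hq1 1 (lp.single 2 (chainIdx t p j) (1 : ℂ))‖ ^ 2 =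
      T (Q ^ (n0 + j)) (Q ^ (k0 + j)) - T (Q ^ (n0 + (j + 1))) (Q ^ (k0 + (j + 1))) := by
    intro j
    rw [chainIdx, norm_alphaTildeW_single_sq]
    have h0 : (if n0 + j = 0 ∨ k0 + j = 0 then 0 else offDiag q (n0 + j - 1) (k0 + j - 1) ^ 2) =
        Q⁻¹ * Q ^ (n0 + j) * (1 - Q ^ (n0 + j)) * (1 - (Q ^ (k0 + j)) ^ 2) := by
      split_ifs with h0
      · rcases h0 with h0 | h0 <;> rw [h0] <;> simp
      · obtain ⟨n, hn⟩ : ∃ m, n0 + j = m + 1 := ⟨n0 + j - 1, by omega⟩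
        obtain ⟨k, hk⟩ : ∃ m, k0 + j = m + 1 := ⟨k0 + j - 1, by omega⟩
        rw [hn, hk, sq_offDiag hq0 hq1]
        simp only [Nat.add_sub_cancel, ← hQ]
        rw [mul_comm 2, pow_mul, pow_succ Q n]
        field_simp
    rw [h0, sq_offDiag hq0 hq1, onDiag, ← add_assoc n0, ← add_assoc k0]
    have e1 : q ^ (n0 + j) * q ^ (n0 + j) = Q ^ (n0 + j) := by rw [hQ]; ring
    have e2 : q ^ (2 * (k0 + j)) = Q ^ (k0 + j) := by rw [hQ, pow_mul]
    have e3 : (q ^ 2) ^ (2 * (k0 + j + 1)) = (Q ^ (k0 + j) * Q) ^ 2 := by rw [hQ]; ring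
    rw [e1, e2, e3, ← hQ, pow_succ Q (n0 + j), pow_succ Q (k0 + j)]
    generalize Q ^ (n0 + j) = X
    generalize Q ^ (k0 + j) = Z
    simp only [hT]
    clear_value Q
    have hQ4 : 1 - Q ^ 2 = (1 - Q) * (1 + Q) := by ring
    have hQ5 : 1 + Q ≠ 0 := by linarith
    rw [hQ4]
    field_simp
    ring
  have hT0 : T (Q ^ n0) (Q ^ k0) = (1 + (Q ^ n0) ^ 2) / (1 - Q ^ 2) := by
    have hQ4 : 1 - Q ^ 2 = (1 - Q) * (1 + Q) := by ring
    have hQ5 : 1 + Q ≠ 0 := by linarith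
    simp only [hT]
    rcases hnk with h | h
    · rw [h, pow_zero]
      generalize Q ^ k0 = Z
      clear_value Q
      rw [hQ4]
      field_simp
      ring
    · rw [h, pow_zero]
      generalize Q ^ n0 = X
      clear_value Q
      rw [hQ4]
      field_simp
      ring
  rw [hasSum_iff_tendsto_nat_of_nonneg (fun j => by positivity)]
  have hpart : ∀ N, ∑ j ∈ Finset.range N,
      ‖alphaTildeW q hq0 hq1 1 (lp.single 2 (chainIdx t p j) (1 : ℂ))‖ ^ 2 =
      (1 + (Q ^ n0) ^ 2) / (1 - Q ^ 2) - T (Q ^ (n0 + N)) (Q ^ (k0 + N)) := fun N => by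
    rw [Finset.sum_congr rfl fun j _ => hterm j,
      Finset.sum_range_sub' (fun j => T (Q ^ (n0 + j)) (Q ^ (k0 + j))), add_zero, add_zero, hT0]
  have hpow : ∀ m : ℕ, Tendsto (fun N : ℕ => Q ^ (m + N)) atTop (𝓝 0) := fun m =>
    (tendsto_pow_atTop_nhds_zero_of_lt_one hQ0.le hQ1).comp
      (tendsto_atTop_mono (fun j => by simp) tendsto_id)
  have hTlim : Tendsto (fun N : ℕ => T (Q ^ (n0 + N)) (Q ^ (k0 + N))) atTop (𝓝 0) := by
    have hcont : Continuous fun c : ℝ × ℝ => T c.1 c.2 := by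
      simp only [hT]
      fun_prop
    have h := (hcont.tendsto (0, 0)).comp ((hpow n0).prodMk_nhds (hpow k0))
    have h0 : T 0 0 = 0 := by simp [hT]
    simpa only [h0, Function.comp_def] using h
  simpa only [hpart, sub_zero] using hTlim.const_sub ((1 + (Q ^ n0) ^ 2) / (1 - Q ^ 2))

/-- The labels `(ε, r)` of the eigenvectors in the invariant subspace with labels `t, p`. -/
def chainLabel (t p : ℤ) : ℕ ⊕ ℕ → EigenLabel
  | Sum.inl r => ⟨((1, r), (t, p)), mem_indexJ_one _⟩
  | Sum.inr s => ⟨((-1, (-p).toNat + s), (t, p)), by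
      rw [mem_indexJ_neg_one]
      dsimp only
      omega⟩

theorem chainLabel_injective (t p : ℤ) : Function.Injective (chainLabel t p) := by
  have hne : (1 : ℤˣ) ≠ -1 := by decide
  rintro (r | r) (s | s) h <;> simp only [chainLabel, Subtype.mk.injEq, Prod.mk.injEq] at h
  · rw [h.1.2]
  · exact absurd h.1.1 hne
  · exact absurd h.1.1 hne.symm
  · have := h.1.2
    rw [show r = s by omega]

/-- Two geometric series: positive eigenvalues start at r = 0, negative ones at r = max(0, -p). -/
theorem hasSum_chainLabel_sq (hq0 : 0 < q) (hq1 : q < 1) (t p : ℤ) :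
    HasSum (fun i => eigenLabelValue q (chainLabel t p i) ^ 2)
      ((1 + ((q ^ 2) ^ (-p).toNat) ^ 2) / (1 - (q ^ 2) ^ 2)) := by
  have hQ1 : (q ^ 2) ^ 2 < 1 := by
    rw [← pow_mul]
    exact pow_lt_one₀ hq0.le hq1 (by norm_num)
  have hg := hasSum_geometric_of_lt_one (by positivity) hQ1
  rw [add_div, one_div, div_eq_mul_inv]
  refine HasSum.sum ?_ ?_
  · refine hg.congr_fun ?_
    intro r
    simp only [Function.comp_apply, chainLabel, eigenLabelValue, sgn_one]
    ring
  · refine (hg.mul_left (((q ^ 2) ^ (-p).toNat) ^ 2)).congr_fun ?_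
    intro s
    simp only [Function.comp_apply, chainLabel, eigenLabelValue, sgn_neg_one]
    ring

theorem alphaTildeW_eq_zero_of_inner (hq0 : 0 < q) (hq1 : q < 1) {x : L2 ((ℕ × ℤ) × ℕ)}
    (hx : ∀ i, ⟪eigenFamily hq0 hq1 i, x⟫_ℂ = 0) : alphaTildeW q hq0 hq1 1 x = 0 := by
  ext i
  obtain ⟨j, hj⟩ : i ∈ Set.range (chainIdx (i.1.1 + i.1.2) (i.2 - i.1.1)) :=
    mem_range_chainIdx.2 ⟨rfl, rfl⟩
  set t := (i.1.1 : ℤ) + i.1.2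
  set p := (i.2 : ℤ) - i.1.1
  have h := ((orthonormal_eigenFamily hq0 hq1).comp _
    (chainLabel_injective t p)).inner_eq_zero_of_hasSum_sq (alphaTildeW q hq0 hq1 1)
    (fun l => eigenLabelValue q (chainLabel t p l))
    (fun l y => inner_eigenFamily_alphaTildeW hq0 hq1 _ y)
    (fun j => lp.single 2 (chainIdx t p j) (1 : ℂ)) (fun l => by
      obtain ⟨hl1, hl2⟩ : (chainLabel t p l).1.2 = (t, p) ∧ True := by
        rcases l with r | s <;> simp [chainLabel]
      have := hasSum_eigenCoord_chainIdx hq0 hq1 (chainLabel t p l).1.2.1 (chainLabel t p l).2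
      rw [hl1] at this
      refine this.congr_fun ?_
      intro j
      rw [← inner_conj_symm, L2_inner_single, RCLike.norm_conj]
      simp only [Function.comp_apply, eigenFamily, eigenVec_apply]
      rw [hl1])
    (hasSum_chainLabel_sq hq0 hq1 t p) (hasSum_norm_alphaTildeW_sq hq0 hq1 t p)
    (fun l => hx _) j
  have h2 : ⟪x, alphaTildeW q hq0 hq1 1 (lp.single 2 (chainIdx t p j) (1 : ℂ))⟫_ℂ = 0 := h
  rw [← alphaTildeW_inner, hj, ← inner_conj_symm, L2_inner_single] at h2
  exact (map_eq_zero _).1 h2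

theorem eq_zero_of_alphaTildeW_eq_zero (hq0 : 0 < q) (hq1 : q < 1) {x : L2 ((ℕ × ℤ) × ℕ)}
    (hx : alphaTildeW q hq0 hq1 1 x = 0) : x = 0 := by
  ext i
  obtain ⟨j, hj⟩ : i ∈ Set.range (chainIdx (i.1.1 + i.1.2) (i.2 - i.1.1)) :=
    mem_range_chainIdx.2 ⟨rfl, rfl⟩
  set t := (i.1.1 : ℤ) + i.1.2
  set p := (i.2 : ℤ) - i.1.1
  rw [← hj]
  refine eq_zero_of_recurrence (c := fun j => offDiag q ((-p).toNat + j) (p.toNat + j))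
    (d := fun j => onDiag q ((-p).toNat + j) (p.toNat + j)) (x := fun j => x (chainIdx t p j))
    (B := ‖x‖) (fun j => offDiag_pos hq0 hq1 _ _) (ρ := (1 + q) / 2) (by positivity) (by linarith)
    (eventually_offDiag_ratio hq0 hq1 _ _) (fun j => lp.norm_apply_le_norm two_ne_zero x _)
    (fun j => ?_) j
  -- Only the rows after the first one are used; boundedness of the coordinates replaces the
  -- boundary condition.
  have h : alphaTildeW q hq0 hq1 1 x (chainIdx t p (j + 1)) = 0 := by rw [hx]; rfl
  have e0 : ((((-p).toNat + (j + 1) - 1, t - ((-p).toNat + (j + 1) : ℕ) + 1),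
      p.toNat + (j + 1) - 1) : (ℕ × ℤ) × ℕ) = chainIdx t p j := by
    simp only [chainIdx, Prod.mk.injEq]
    omega
  have e2 : ((((-p).toNat + (j + 1) + 1, t - ((-p).toNat + (j + 1) : ℕ) - 1),
      p.toNat + (j + 1) + 1) : (ℕ × ℤ) × ℕ) = chainIdx t p (j + 2) := by
    simp only [chainIdx, Prod.mk.injEq]
    omega
  rw [chainIdx, alphaTildeW_apply, if_neg (by omega), e0, e2] at h
  exact h

theorem eq_zero_of_inner_eigenFamily (hq0 : 0 < q) (hq1 : q < 1) {x : L2 ((ℕ × ℤ) × ℕ)}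
    (hx : ∀ i, ⟪eigenFamily hq0 hq1 i, x⟫_ℂ = 0) : x = 0 :=
  eq_zero_of_alphaTildeW_eq_zero hq0 hq1 (alphaTildeW_eq_zero_of_inner hq0 hq1 hx)

end Completeness

/-! ### Diagonalisation: the Hilbert basis, the spectrum and the eigenspaces. -/

open scoped InnerProductSpace in
theorem span_eigenFamily_orthogonal {q : ℝ} (hq0 : 0 < q) (hq1 : q < 1) :
    (Submodule.span ℂ (Set.range (eigenFamily hq0 hq1)))ᗮ = ⊥ := by
  rw [Submodule.eq_bot_iff]
  intro x hx
  exact eq_zero_of_inner_eigenFamily hq0 hq1 fun i =>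
    (Submodule.mem_orthogonal _ _).1 hx _ (Submodule.subset_span ⟨i, rfl⟩)

/-- The Hilbert basis of eigenvectors of `α̃₊(W)`. -/
noncomputable def eigenBasis {q : ℝ} (hq0 : 0 < q) (hq1 : q < 1) :
    HilbertBasis EigenLabel ℂ (L2 ((ℕ × ℤ) × ℕ)) :=
  HilbertBasis.mkOfOrthogonalEqBot (orthonormal_eigenFamily hq0 hq1)
    (span_eigenFamily_orthogonal hq0 hq1)

theorem eigenBasis_repr_alphaTildeW {q : ℝ} (hq0 : 0 < q) (hq1 : q < 1) (y : L2 ((ℕ × ℤ) × ℕ))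
    (i : EigenLabel) :
    (eigenBasis hq0 hq1).repr (alphaTildeW q hq0 hq1 1 y) i =
      eigenLabelValue q i * (eigenBasis hq0 hq1).repr y i := by
  rw [HilbertBasis.repr_apply_apply, HilbertBasis.repr_apply_apply, eigenBasis,
    HilbertBasis.coe_mkOfOrthogonalEqBot, inner_eigenFamily_alphaTildeW]

/-- A bounded operator that is diagonal in a Hilbert basis has no spectrum at positive distance
from its diagonal entries. -/
theorem HilbertBasis.notMem_spectrum {H : Type*} {ι : Type} [NormedAddCommGroup H]
    [InnerProductSpace ℂ H] [CompleteSpace H] (b : HilbertBasis ι ℂ H) (A : H →L[ℂ] H)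
    {lam : ι → ℂ} (hA : ∀ y i, b.repr (A y) i = lam i * b.repr y i) {z : ℂ} {δ : ℝ} (hδ : 0 < δ)
    (hz : ∀ i, δ ≤ ‖z - lam i‖) : z ∉ spectrum ℂ A := by
  have hne : ∀ i, z - lam i ≠ 0 := fun i h => by
    have := hz i
    rw [h, norm_zero] at this
    linarith
  have hrepr : ∀ y i, b.repr ((algebraMap ℂ (H →L[ℂ] H) z - A) y) i =
      (z - lam i) * b.repr y i := fun y i => by
    have h1 : (algebraMap ℂ (H →L[ℂ] H) z - A) y = z • y - A y := by
      rw [Algebra.algebraMap_eq_smul_one]; rfl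
    have h2 : b.repr (z • y - A y) i = z * b.repr y i - b.repr (A y) i := by
      rw [map_sub, map_smul]; rfl
    rw [h1, h2, hA, sub_mul]
  rw [spectrum.notMem_iff, ContinuousLinearMap.isUnit_iff_bijective]
  constructor
  · rw [injective_iff_map_eq_zero]
    intro y hy
    refine b.repr.injective ?_
    rw [map_zero]
    ext i
    have h := hrepr y i
    rw [hy, map_zero] at h
    exact (mul_eq_zero.1 h.symm).resolve_left (hne i)
  · intro y
    -- The inverse is diagonal with entries bounded by δ⁻¹.
    have hs : Memℓp (fun i => (z - lam i)⁻¹ * b.repr y i) 2 := by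
      refine (memlp_two_iff _).2 (Summable.of_nonneg_of_le (fun i => by positivity) (fun i => ?_)
        ((L2_summable (b.repr y)).mul_left ((δ⁻¹) ^ 2)))
      rw [norm_mul, mul_pow, norm_inv]
      have := hz i
      gcongr
    refine ⟨b.repr.symm ⟨_, hs⟩, b.repr.injective ?_⟩
    ext i
    rw [hrepr, LinearIsometryEquiv.apply_symm_apply]
    exact mul_inv_cancel_left₀ (hne i) _

theorem isClosed_eigenvalues_union_zero {q : ℝ} (hq0 : 0 < q) (hq1 : q < 1) :
    IsClosed {z : ℂ | (∃ (ε : ℤˣ) (r : ℕ), z = ((sgn ε * q ^ (2 * r) : ℝ) : ℂ)) ∨ z = 0} := by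
  have hlim : ∀ ε : ℤˣ, Filter.Tendsto (fun r : ℕ => ((sgn ε * q ^ (2 * r) : ℝ) : ℂ)) Filter.atTop
      (nhds 0) := fun ε => by
    have h1 : Filter.Tendsto (fun r : ℕ => sgn ε * (q ^ 2) ^ r) Filter.atTop (nhds 0) := by
      simpa using (tendsto_pow_atTop_nhds_zero_of_lt_one (by positivity)
        (pow_lt_one₀ hq0.le hq1 two_ne_zero)).const_mul (sgn ε)
    have h2 := (Complex.continuous_ofReal.tendsto 0).comp h1
    rw [Complex.ofReal_zero] at h2
    refine h2.congr fun r => ?_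
    simp only [Function.comp_apply, pow_mul]
  have h := ((hlim 1).isCompact_insert_range.union (hlim (-1)).isCompact_insert_range).isClosed
  convert h using 1
  ext z
  simp only [Set.mem_ofPred_eq, Set.mem_union, Set.mem_insert_iff, Set.mem_range]
  constructor
  · rintro (⟨ε, r, rfl⟩ | rfl)
    · rcases Int.units_eq_one_or ε with rfl | rfl
      · exact Or.inl (Or.inr ⟨r, rfl⟩)
      · exact Or.inr (Or.inr ⟨r, rfl⟩)
    · exact Or.inl (Or.inl rfl)
  · rintro ((rfl | ⟨r, rfl⟩) | (rfl | ⟨r, rfl⟩))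
    · exact Or.inr rfl
    · exact Or.inl ⟨_, r, rfl⟩
    · exact Or.inr rfl
    · exact Or.inl ⟨_, r, rfl⟩

theorem spectrum_alphaTildeW {q : ℝ} (hq0 : 0 < q) (hq1 : q < 1) :
    spectrum ℂ (alphaTildeW q hq0 hq1 1) =
      {z : ℂ | (∃ (ε : ℤˣ) (r : ℕ), z = ((sgn ε * q ^ (2 * r) : ℝ) : ℂ)) ∨ z = 0} := by
  have hmem : ∀ (ε : ℤˣ) (r : ℕ), ((sgn ε * q ^ (2 * r) : ℝ) : ℂ) ∈
      spectrum ℂ (alphaTildeW q hq0 hq1 1) := fun ε r => by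
    obtain ⟨p, hp⟩ : ∃ p : ℤ, p + r ∈ indexJ ε := by
      refine ⟨0, ?_⟩
      rcases Int.units_eq_one_or ε with rfl | rfl
      · exact mem_indexJ_one _
      · exact mem_indexJ_neg_one.2 (by omega)
    rw [spectrum.mem_iff, ContinuousLinearMap.isUnit_iff_bijective]
    rintro ⟨hinj, -⟩
    have h0 : eigenVec hq0 hq1 0 hp = 0 := hinj (by
      rw [map_zero, Algebra.algebraMap_eq_smul_one]
      have : ((((sgn ε * q ^ (2 * r) : ℝ) : ℂ) • (1 : L2 ((ℕ × ℤ) × ℕ) →L[ℂ] L2 ((ℕ × ℤ) × ℕ)) -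
        alphaTildeW q hq0 hq1 1) (eigenVec hq0 hq1 0 hp)) = ((sgn ε * q ^ (2 * r) : ℝ) : ℂ) •
          eigenVec hq0 hq1 0 hp - alphaTildeW q hq0 hq1 1 (eigenVec hq0 hq1 0 hp) := rfl
      rw [this, alphaTildeW_eigenVec, sub_self])
    have h1 := norm_eigenVec hq0 hq1 0 hp
    rw [h0, norm_zero] at h1
    exact zero_ne_one h1
  apply Set.Subset.antisymm
  · intro z hz
    by_contra hzS
    obtain ⟨δ, hδ, hball⟩ := Metric.isOpen_iff.1
      (isClosed_eigenvalues_union_zero hq0 hq1).isOpen_compl z hzS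
    refine (eigenBasis hq0 hq1).notMem_spectrum (alphaTildeW q hq0 hq1 1)
      (fun y i => eigenBasis_repr_alphaTildeW hq0 hq1 y i) hδ (fun i => ?_) hz
    by_contra hlt
    rw [not_le, ← dist_eq_norm, dist_comm] at hlt
    exact hball (Metric.mem_ball.2 hlt) (Or.inl ⟨i.1.1.1, i.1.1.2, rfl⟩)
  · rintro z (⟨ε, r, rfl⟩ | rfl)
    · exact hmem ε r
    · have h1 : Filter.Tendsto (fun r : ℕ => ((sgn 1 * q ^ (2 * r) : ℝ) : ℂ)) Filter.atTop
          (nhds 0) := by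
        have h1 : Filter.Tendsto (fun r : ℕ => sgn 1 * (q ^ 2) ^ r) Filter.atTop (nhds 0) := by
          simpa using (tendsto_pow_atTop_nhds_zero_of_lt_one (by positivity)
            (pow_lt_one₀ hq0.le hq1 two_ne_zero)).const_mul (sgn 1)
        have h2 := (Complex.continuous_ofReal.tendsto 0).comp h1
        rw [Complex.ofReal_zero] at h2
        refine h2.congr fun r => ?_
        simp only [Function.comp_apply, pow_mul]
      -- Zero belongs to the spectrum only as a limit of eigenvalues.
      exact (spectrum.isClosed _).mem_of_tendsto h1 (Filter.Eventually.of_forall fun r => hmem 1 r)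

theorem not_hasEigenvalue_alphaTildeW_zero {q : ℝ} (hq0 : 0 < q) (hq1 : q < 1) :
    ¬ Module.End.HasEigenvalue
        (alphaTildeW q hq0 hq1 1 : L2 ((ℕ × ℤ) × ℕ) →ₗ[ℂ] L2 ((ℕ × ℤ) × ℕ)) 0 := by
  intro h
  obtain ⟨x, hx, hx0⟩ := h.exists_hasEigenvector
  refine hx0 (eq_zero_of_alphaTildeW_eq_zero hq0 hq1 ?_)
  have := Module.End.mem_eigenspace_iff.1 hx
  rwa [zero_smul] at this

open scoped InnerProductSpace in
-- A vector of the eigenspace is automatically orthogonal to the eigenvectors for other eigenvalues.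
-- If it is also orthogonal to those listed here, it vanishes by `eq_zero_of_inner_eigenFamily`.
theorem exists_hilbertBasis_eigenspace {q : ℝ} (hq0 : 0 < q) (hq1 : q < 1) (r : ℕ) (ε : ℤˣ) :
    ∃ ξ : HilbertBasis {tp : ℤ × ℤ // tp.2 + r ∈ indexJ ε} ℂ
        (Module.End.eigenspace
          (alphaTildeW q hq0 hq1 1 : L2 ((ℕ × ℤ) × ℕ) →ₗ[ℂ] L2 ((ℕ × ℤ) × ℕ))
          ((sgn ε * q ^ (2 * r) : ℝ) : ℂ)),
      ∀ tp, (ξ tp : L2 ((ℕ × ℤ) × ℕ)) = eigenVec hq0 hq1 tp.1.1 tp.2 := by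
  set E := Module.End.eigenspace
    (alphaTildeW q hq0 hq1 1 : L2 ((ℕ × ℤ) × ℕ) →ₗ[ℂ] L2 ((ℕ × ℤ) × ℕ))
    ((sgn ε * q ^ (2 * r) : ℝ) : ℂ) with hE
  have hmemE : ∀ x, x ∈ E ↔ alphaTildeW q hq0 hq1 1 x = ((sgn ε * q ^ (2 * r) : ℝ) : ℂ) • x :=
    fun x => Module.End.mem_eigenspace_iff
  have hclosed : IsClosed (E : Set (L2 ((ℕ × ℤ) × ℕ))) := by
    have : (E : Set (L2 ((ℕ × ℤ) × ℕ))) =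
        {x | alphaTildeW q hq0 hq1 1 x = ((sgn ε * q ^ (2 * r) : ℝ) : ℂ) • x} :=
      Set.ext fun x => hmemE x
    rw [this]
    exact isClosed_eq (alphaTildeW q hq0 hq1 1).continuous (continuous_const_smul _)
  have : CompleteSpace E := hclosed.completeSpace_coe
  let lab : {tp : ℤ × ℤ // tp.2 + r ∈ indexJ ε} → EigenLabel := fun tp => ⟨((ε, r), tp.1), tp.2⟩
  have hlab : Function.Injective lab := fun a b h => by
    simp only [lab, Subtype.mk.injEq, Prod.mk.injEq, true_and] at h
    exact Subtype.ext h
  let v : {tp : ℤ × ℤ // tp.2 + r ∈ indexJ ε} → E := fun tp =>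
    ⟨eigenVec hq0 hq1 tp.1.1 tp.2, (hmemE _).2 (alphaTildeW_eigenVec hq0 hq1 _ _)⟩
  have hv : Orthonormal ℂ v := by
    have h := (orthonormal_eigenFamily hq0 hq1).comp lab hlab
    exact ⟨fun i => h.1 i, fun i j hij => h.2 hij⟩
  have hbot : (Submodule.span ℂ (Set.range v))ᗮ = ⊥ := by
    rw [Submodule.eq_bot_iff]
    intro x hx
    refine Subtype.ext (eq_zero_of_inner_eigenFamily hq0 hq1 fun i => ?_)
    by_cases hi : i.1.1 = (ε, r)
    · obtain ⟨⟨⟨ε', r'⟩, tp⟩, hi2⟩ := i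
      simp only [Prod.mk.injEq] at hi
      obtain ⟨rfl, rfl⟩ := hi
      exact (Submodule.mem_orthogonal _ _).1 hx _ (Submodule.subset_span ⟨⟨tp, hi2⟩, rfl⟩)
    · have hne : eigenLabelValue q i ≠ sgn ε * q ^ (2 * r) := fun h => by
        obtain ⟨h1, h2⟩ := eigenvalue_injective hq0 hq1 h
        exact hi (Prod.ext h1 h2)
      have h := inner_eigenFamily_alphaTildeW hq0 hq1 i x
      rw [(hmemE _).1 x.2, inner_smul_right] at h
      have h2 : ((eigenLabelValue q i : ℂ) - (sgn ε * q ^ (2 * r) : ℝ)) *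
          ⟪eigenFamily hq0 hq1 i, x⟫_ℂ = 0 := by
        rw [sub_mul, ← h, sub_self]
      refine (mul_eq_zero.1 h2).resolve_left ?_
      rw [← Complex.ofReal_sub]
      exact_mod_cast sub_ne_zero.2 hne
  refine ⟨HilbertBasis.mkOfOrthogonalEqBot hv hbot, fun tp => ?_⟩
  rw [HilbertBasis.coe_mkOfOrthogonalEqBot]

theorem mainTheorem5 (q : ℝ) (hq0 : 0 < q) (hq1 : q < 1) :
    spectrum ℂ (alphaTildeW q hq0 hq1 1) =
        {z : ℂ | (∃ (ε : ℤˣ) (r : ℕ), z = ((sgn ε * q ^ (2 * r) : ℝ) : ℂ)) ∨ z = 0} ∧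
    ¬ Module.End.HasEigenvalue
        (alphaTildeW q hq0 hq1 1 : L2 ((ℕ × ℤ) × ℕ) →ₗ[ℂ] L2 ((ℕ × ℤ) × ℕ)) 0 ∧
    ∀ (r : ℕ) (ε : ℤˣ),
      ∃ ξ : HilbertBasis {tp : ℤ × ℤ // tp.2 + r ∈ indexJ ε} ℂ
          (Module.End.eigenspace
            (alphaTildeW q hq0 hq1 1 : L2 ((ℕ × ℤ) × ℕ) →ₗ[ℂ] L2 ((ℕ × ℤ) × ℕ))
            ((sgn ε * q ^ (2 * r) : ℝ) : ℂ)),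
        ∀ (t p : ℤ) (h : p + r ∈ indexJ ε),
          HasSum (fun n : ℕ => (coeffQ q ε p r n : ℂ) • basisVec n (t - n) (p + n))
            (ξ ⟨(t, p), h⟩ : L2 ((ℕ × ℤ) × ℕ)) := by
  refine ⟨spectrum_alphaTildeW hq0 hq1, not_hasEigenvalue_alphaTildeW_zero hq0 hq1, fun r ε => ?_⟩
  obtain ⟨ξ, hξ⟩ := exists_hilbertBasis_eigenspace hq0 hq1 r ε
  refine ⟨ξ, fun t p h => ?_⟩
  rw [hξ]
  exact hasSum_eigenVec hq0 hq1 t h
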